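/- Let $m\ge 1$ and $d>2m$ be integers. Let $(G_n)_{n\ge m}$ be the following random graph process: $G_m$ is the complete graph on $m$ vertices and, for $n\ge m$, given $G_m,\dots,G_n$, the graph $G_{n+1}$ is obtained from $G_n$ by adding a new vertex and joining it to the $m$ vertices of a set chosen uniformly at random among all $m$-element sets of vertices of $G_n$ of degree less than $d$. For $m\le k\le d$, let $N_k(n)$ be the number of vertices of degree $k$ in $G_n$ and let $X_k(n)=N_k(n)/n$. The equation $$\left(\frac{m}{m+1-x}\right)^{d-m}=x$$ has a unique root $x=\rho_d$ in the interval $(0,2m/d)$. Put $$\rho_k=\frac{(1-\rho_d)\,m^{k-m}}{(m+1-\rho_d)^{k-m+1}},\qquad k=m,\dots,d-1.$$ Then almost surely, for every $k\in\{m,\dots,d\}$, $X_k(n)\to\rho_k$ as $n\to\infty$ and, for every $\delta>0$, $|X_k(n)-\rho_k|=o(n^{-1/2+\delta})$. -/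

import Mathlib

open MeasureTheory Filter Topology Asymptotics

/-- The vertices of `G` whose degree is less than `d`. -/
noncomputable def eligibleVertices (d : ℕ) {n : ℕ} (G : SimpleGraph (Fin n)) : Finset (Fin n) :=
  open Classical in Finset.univ.filter fun v => G.degree v < d

/-- The graph obtained from `G` by adding one new vertex (the last one) and joining it to exactly
the vertices in `S`. -/
def addVertex {n : ℕ} (G : SimpleGraph (Fin n)) (S : Finset (Fin n)) :
    SimpleGraph (Fin (n + 1)) :=
  G.map Fin.castSuccEmb ⊔
    SimpleGraph.fromRel fun a b => a = Fin.last n ∧ ∃ v ∈ S, b = Fin.castSucc v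

/-- `(G n)`, `n ≥ m`, is a uniform attachment process with parameter `m` and degrees bounded by `d`:
`G m` is the complete graph on `m` vertices and, given `G m, …, G n`, the graph `G (n + 1)` arises
from `G n` by joining a new vertex to a uniformly random `m`-element set of vertices of degree
less than `d`. -/
structure IsBoundedUniformAttachment {Ω : Type*} [MeasurableSpace Ω] (μ : Measure Ω) (m d : ℕ)
    (G : (n : ℕ) → Ω → SimpleGraph (Fin n)) : Prop where
  measurableSet_eq : ∀ n, m ≤ n → ∀ H : SimpleGraph (Fin n), MeasurableSet {ω | G n ω = H}
  initial : ∀ᵐ ω ∂μ, G m ω = ⊤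
  step : ∀ n, m ≤ n → ∀ g : (i : ℕ) → SimpleGraph (Fin i),
    ∀ S ∈ (eligibleVertices d (g n)).powersetCard m,
      μ.real {ω | (∀ i ∈ Finset.Icc m n, G i ω = g i) ∧ G (n + 1) ω = addVertex (g n) S} =
        μ.real {ω | ∀ i ∈ Finset.Icc m n, G i ω = g i} *
          (1 / ((eligibleVertices d (g n)).card.choose m : ℝ))

/-- The number of vertices of degree `k`. -/
noncomputable def numDegree (k : ℕ) {n : ℕ} (G : SimpleGraph (Fin n)) : ℕ :=
  open Classical in (Finset.univ.filter fun v => G.degree v = k).card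

/-- `x` is a root in `(0, 2m/d)` of `(m / (m + 1 - x)) ^ (d - m) = x`. -/
def IsTopRoot (m d : ℕ) (x : ℝ) : Prop :=
  x ∈ Set.Ioo (0 : ℝ) (2 * m / d) ∧ ((m : ℝ) / (m + 1 - x)) ^ (d - m) = x

/-- The limiting proportion of vertices of degree `k`, `m ≤ k ≤ d`, where `x` is the limiting
proportion of vertices of degree `d`. -/
noncomputable def limitProportion (m d : ℕ) (x : ℝ) (k : ℕ) : ℝ :=
  if k = d then x else (1 - x) * (m : ℝ) ^ (k - m) / ((m : ℝ) + 1 - x) ^ (k - m + 1)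

/-!
Almost surely, the vector `v` of the numbers of vertices of degrees `m, …, d - 1` moves by
`(m / E) • (S v - v)` plus a centred bounded error, where `E` is the number of eligible vertices
and `S` shifts the entries of `v` by one place and puts `E / m`, a multiple of the sum of the
entries, in front. Azuma's inequality and the Borel–Cantelli lemma bound the accumulated error by
`O(√(n log n))`.

The profile `(ρ_m, …, ρ_{d - 1})` is geometric with ratio `r = m / (m + 1 - ρ_d)`, and the equation
for `ρ_d` is the Euler–Lotka equation `r + r ^ 2 + ⋯ + r ^ (d - m) = m`, which says that the profile
spans the kernel of `Δ = r S - 1`. The image of `Δ` is a hyperplane, and on it `S` agrees with a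
shift whose feedback weights `r ^ (d - m - i) / m` are nonnegative with sum one, hence with a
contraction for the supremum norm. So the recursion for `Δ v` does not amplify the errors, and
`Δ v = O(n ^ β)` for every `β > 1 / 2`. The component of `v` along the profile needs no analysis:
counting edges determines the sum of `d - deg` over all vertices exactly.
-/

section FiniteMeasure

variable {Ω : Type*} {mΩ : MeasurableSpace Ω}

theorem comap_top_le_of_measurableSet_preimage_singleton {α : Type*} [Countable α] {h : Ω → α}
    (hh : ∀ a, MeasurableSet (h ⁻¹' {a})) : MeasurableSpace.comap h ⊤ ≤ mΩ := by
  rintro _ ⟨t, -, rfl⟩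
  rw [← Set.biUnion_preimage_singleton]
  exact MeasurableSet.biUnion t.to_countable fun a _ => hh a

variable {μ : Measure Ω} [IsFiniteMeasure μ]

theorem condExp_comap_top_ae_eq {α : Type*} [Finite α] {h : Ω → α}
    (hh : ∀ a, MeasurableSet (h ⁻¹' {a})) {f : Ω → ℝ} (hf : Integrable f μ) {g : α → ℝ}
    (hfg : ∀ a, ∫ ω in h ⁻¹' {a}, f ω ∂μ = μ.real (h ⁻¹' {a}) * g a) :
    μ[f | MeasurableSpace.comap h ⊤] =ᵐ[μ] g ∘ h := by
  have hle := comap_top_le_of_measurableSet_preimage_singleton hh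
  have hgm : StronglyMeasurable[MeasurableSpace.comap h ⊤] (g ∘ h) :=
    (measurable_from_top.comp (comap_measurable h)).stronglyMeasurable
  have hgi : Integrable (g ∘ h) μ := by
    obtain ⟨C, hC⟩ := (Set.finite_range fun a => ‖g a‖).bddAbove
    exact .of_bound (hgm.mono hle).aestronglyMeasurable C (ae_of_all _ fun ω => hC ⟨h ω, rfl⟩)
  have hsum {s : Set α} {u : Ω → ℝ} (hu : Integrable u μ) :
      ∫ ω in h ⁻¹' s, u ω ∂μ = ∑ a ∈ s.toFinite.toFinset, ∫ ω in h ⁻¹' {a}, u ω ∂μ := by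
    rw [← Set.biUnion_preimage_singleton, ← integral_biUnion_finset _ (fun a _ => hh a)
      (fun a _ b _ hab => (Set.disjoint_singleton.2 hab).preimage h) fun a _ => hu.integrableOn]
    simp only [Set.Finite.mem_toFinset]
  refine (ae_eq_condExp_of_forall_setIntegral_eq hle hf (fun _ _ _ => hgi.integrableOn) ?_
    hgm.aestronglyMeasurable).symm
  rintro _ ⟨s, -, rfl⟩ -
  rw [hsum hgi, hsum hf]
  refine Finset.sum_congr rfl fun a _ => ?_
  calc ∫ ω in h ⁻¹' {a}, (g ∘ h) ω ∂μ = ∫ _ in h ⁻¹' {a}, g a ∂μ :=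
        setIntegral_congr_fun (hh a) fun ω hω => congrArg g hω
    _ = ∫ ω in h ⁻¹' {a}, f ω ∂μ := by rw [setIntegral_const, smul_eq_mul, hfg]

theorem exp_mul_le_cosh_add_mul_sinh {y b : ℝ} (hy : |y| ≤ b) (t : ℝ) :
    Real.exp (t * y) ≤ Real.cosh (t * b) + y * (Real.sinh (t * b) / b) := by
  obtain rfl | hb := ((abs_nonneg y).trans hy).eq_or_lt
  · simp [abs_nonpos_iff.1 hy]
  · have hyb : |y / b| ≤ 1 := by rwa [abs_div, abs_of_pos hb, div_le_one hb]
    calc Real.exp (t * y) = Real.exp (y / b * (t * b)) := by field_simp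
      _ ≤ Real.cosh (t * b) + y / b * Real.sinh (t * b) :=
        Real.exp_mul_le_cosh_add_mul_sinh hyb _
      _ = Real.cosh (t * b) + y * (Real.sinh (t * b) / b) := by ring

theorem integral_mul_eq_zero_of_condExp_eq_zero {ℱ : MeasurableSpace Ω} (hℱ : ℱ ≤ mΩ)
    {f Y : Ω → ℝ} (hf : StronglyMeasurable[ℱ] f) (hfY : Integrable (f * Y) μ)
    (hY : Integrable Y μ) (hY0 : μ[Y | ℱ] =ᵐ[μ] 0) : ∫ ω, f ω * Y ω ∂μ = 0 := by
  calc ∫ ω, f ω * Y ω ∂μ = ∫ ω, (μ[f * Y | ℱ]) ω ∂μ := (integral_condExp hℱ).symm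
    _ = ∫ _, 0 ∂μ := by
      refine integral_congr_ae ?_
      filter_upwards [condExp_mul_of_stronglyMeasurable_left hf hfY hY, hY0] with ω h h0
      rw [h, Pi.mul_apply, h0, Pi.zero_apply, mul_zero]
    _ = 0 := integral_zero _ _

theorem hasSubgaussianMGF_add_of_condExp_eq_zero {ℱ : MeasurableSpace Ω} (hℱ : ℱ ≤ mΩ)
    {X Y : Ω → ℝ} {c b : NNReal} (hX : ProbabilityTheory.HasSubgaussianMGF X c μ)
    (hXℱ : StronglyMeasurable[ℱ] X) (hY : Integrable Y μ) (hYb : ∀ᵐ ω ∂μ, |Y ω| ≤ b)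
    (hY0 : μ[Y | ℱ] =ᵐ[μ] 0) : ProbabilityTheory.HasSubgaussianMGF (X + Y) (c + b ^ 2) μ := by
  have hexp (t : ℝ) : Integrable (fun ω => Real.exp (t * X ω) * Real.exp (t * Y ω)) μ := by
    refine (hX.integrable_exp_mul t).mul_bdd (c := Real.exp (|t| * b))
      (Real.continuous_exp.comp_aestronglyMeasurable (hY.1.const_mul t)) ?_
    filter_upwards [hYb] with ω hω
    rw [Real.norm_eq_abs, Real.abs_exp, Real.exp_le_exp]
    exact (le_abs_self _).trans (by rw [abs_mul]; gcongr)
  refine ⟨fun t => by simpa only [Pi.add_apply, mul_add, Real.exp_add] using hexp t, fun t => ?_⟩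
  have hmul : Integrable (fun ω => Real.exp (t * X ω) * Y ω) μ :=
    (hX.integrable_exp_mul t).mul_bdd hY.1 hYb
  calc ProbabilityTheory.mgf (X + Y) μ t = ∫ ω, Real.exp (t * X ω) * Real.exp (t * Y ω) ∂μ := by
        simp only [ProbabilityTheory.mgf, Pi.add_apply, mul_add, Real.exp_add]
    _ ≤ ∫ ω, (Real.exp (t * X ω) * Real.cosh (t * b) +
          Real.exp (t * X ω) * Y ω * (Real.sinh (t * b) / b)) ∂μ := by
        refine integral_mono_ae (hexp t)
          (((hX.integrable_exp_mul t).mul_const _).add (hmul.mul_const _)) ?_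
        filter_upwards [hYb] with ω hω
        rw [mul_assoc, ← mul_add]
        exact mul_le_mul_of_nonneg_left (exp_mul_le_cosh_add_mul_sinh hω t) (Real.exp_nonneg _)
    _ = ProbabilityTheory.mgf X μ t * Real.cosh (t * b) := by
        rw [integral_add ((hX.integrable_exp_mul t).mul_const _) (hmul.mul_const _),
          integral_mul_const, integral_mul_const,
          integral_mul_eq_zero_of_condExp_eq_zero hℱ
            (Real.continuous_exp.comp_stronglyMeasurable (hXℱ.const_mul t)) hmul hY hY0,
          zero_mul, add_zero, ProbabilityTheory.mgf]
    _ ≤ Real.exp (c * t ^ 2 / 2) * Real.exp ((t * b) ^ 2 / 2) :=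
        mul_le_mul (hX.mgf_le t) (Real.cosh_le_exp_half_sq _) (Real.cosh_pos _).le
          (Real.exp_nonneg _)
    _ = Real.exp ((c + b ^ 2 : NNReal) * t ^ 2 / 2) := by
        rw [← Real.exp_add]; push_cast; ring_nf

end FiniteMeasure

section Azuma

variable {Ω : Type*} {mΩ : MeasurableSpace Ω} {μ : Measure Ω}

theorem measureReal_abs_ge_le_of_hasSubgaussianMGF {X : Ω → ℝ} {c : NNReal}
    (hX : ProbabilityTheory.HasSubgaussianMGF X c μ) {ε : ℝ} (hε : 0 ≤ ε) :
    μ.real {ω | ε ≤ |X ω|} ≤ 2 * Real.exp (-ε ^ 2 / (2 * c)) := by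
  calc μ.real {ω | ε ≤ |X ω|} = μ.real ({ω | ε ≤ X ω} ∪ {ω | ε ≤ (-X) ω}) := by
        congr 1; ext ω; simp [le_abs]
    _ ≤ μ.real {ω | ε ≤ X ω} + μ.real {ω | ε ≤ (-X) ω} := measureReal_union_le _ _
    _ ≤ _ := by linarith [hX.measure_ge_le hε, hX.neg.measure_ge_le hε]

variable [IsProbabilityMeasure μ]

theorem hasSubgaussianMGF_sub_of_abs_sub_le {ℱ : Filtration ℕ mΩ} {M : ℕ → Ω → ℝ} {b : NNReal}
    (hM : Martingale M ℱ μ) (hb : ∀ n, ∀ᵐ ω ∂μ, |M (n + 1) ω - M n ω| ≤ b) (n : ℕ) :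
    ProbabilityTheory.HasSubgaussianMGF (M n - M 0) (n * b ^ 2) μ := by
  induction n with
  | zero => simp
  | succ n ih =>
    have hY0 : μ[M (n + 1) - M n | ℱ n] =ᵐ[μ] 0 := by
      filter_upwards [condExp_sub (hM.integrable (n + 1)) (hM.integrable n) (ℱ n),
        hM.2 n (n + 1) n.le_succ, hM.2 n n le_rfl] with ω h h1 h2
      rw [h, Pi.sub_apply, h1, h2, sub_self, Pi.zero_apply]
    convert hasSubgaussianMGF_add_of_condExp_eq_zero (ℱ.le n) ih
      ((hM.1 n).sub ((hM.1 0).mono (ℱ.mono n.zero_le)))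
      ((hM.integrable (n + 1)).sub (hM.integrable n)) (hb n) hY0 using 1
    · abel
    · push_cast; ring

theorem ae_isBigO_sqrt_mul_log_of_abs_sub_le {ℱ : Filtration ℕ mΩ} {M : ℕ → Ω → ℝ} {b : NNReal}
    (hM : Martingale M ℱ μ) (hb : ∀ n, ∀ᵐ ω ∂μ, |M (n + 1) ω - M n ω| ≤ b) :
    ∀ᵐ ω ∂μ, (fun n => M n ω - M 0 ω) =O[atTop] fun n : ℕ => √(n * Real.log n) := by
  -- With `b + 1` for `b` the tail bound does not degenerate to division by zero when `b = 0`.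
  have hb' (n : ℕ) : ∀ᵐ ω ∂μ, |M (n + 1) ω - M n ω| ≤ (b + 1 : NNReal) := by
    filter_upwards [hb n] with ω hω using hω.trans (by simp)
  set ε : ℕ → ℝ := fun n => 2 * (b + 1) * √(n * Real.log n) with hε
  have htail (n : ℕ) : μ.real {ω | ε n ≤ |(M n - M 0) ω|} ≤ 2 * Real.exp (-(2 * Real.log n)) := by
    refine (measureReal_abs_ge_le_of_hasSubgaussianMGF
      (hasSubgaussianMGF_sub_of_abs_sub_le hM hb' n) (by positivity)).trans_eq ?_
    obtain rfl | hn := eq_or_ne n 0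
    · simp
    · have hsq : √(n * Real.log n) ^ 2 = n * Real.log n :=
        Real.sq_sqrt (mul_nonneg n.cast_nonneg (Real.log_natCast_nonneg n))
      congr 2
      rw [hε, mul_pow, hsq]
      push_cast
      field_simp
  have hsum : ∑' n, μ {ω | ε n ≤ |(M n - M 0) ω|} ≠ ⊤ := by
    have hsq : Summable fun n : ℕ => 2 * ((n : ℝ) ^ 2)⁻¹ :=
      (Real.summable_nat_pow_inv.2 one_lt_two).mul_left 2
    refine ne_of_eq_of_ne (tsum_congr fun n => (ofReal_measureReal (measure_ne_top μ _)).symm)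
      (hsq.of_norm_bounded_eventually_nat ?_).tsum_ofReal_ne_top
    filter_upwards [eventually_gt_atTop 0] with n hn
    have hn' : (0 : ℝ) < n := Nat.cast_pos.2 hn
    rw [Real.norm_of_nonneg measureReal_nonneg]
    refine (htail n).trans_eq ?_
    rw [Real.exp_neg, two_mul (Real.log n), Real.exp_add, Real.exp_log hn', sq]
  filter_upwards [ae_eventually_notMem hsum] with ω hω
  refine IsBigO.of_bound (2 * (b + 1)) (hω.mono fun n hn => ?_)
  rw [Real.norm_eq_abs, Real.norm_eq_abs, abs_of_nonneg (Real.sqrt_nonneg _)]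
  exact (not_le.1 hn).le

end Azuma

section Growth

theorem isBigO_sqrt_mul_log_rpow {β : ℝ} (hβ : 1 / 2 < β) :
    (fun n : ℕ => √(n * Real.log n)) =O[atTop] fun n : ℕ => (n : ℝ) ^ β := by
  have hlog : (fun n : ℕ => Real.log n) =O[atTop] fun n : ℕ => (n : ℝ) ^ (2 * β - 1) :=
    (isLittleO_log_rpow_atTop (by linarith)).isBigO.comp_tendsto tendsto_natCast_atTop_atTop
  refine IsBigO.of_pow two_ne_zero (((isBigO_refl (fun n : ℕ => (n : ℝ)) _).mul hlog).congr' ?_ ?_)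
  · exact .of_forall fun n =>
      (Real.sq_sqrt (mul_nonneg n.cast_nonneg (Real.log_natCast_nonneg n))).symm
  · filter_upwards [eventually_gt_atTop 0] with n hn
    have hn' : (0 : ℝ) < n := Nat.cast_pos.2 hn
    rw [Pi.pow_apply, ← Real.rpow_one_add' hn'.le (by linarith), ← Real.rpow_natCast,
      ← Real.rpow_mul hn'.le]
    congr 1
    push_cast
    ring

theorem rpow_add_min_one_mul_div_le {β : ℝ} (hβ : 0 ≤ β) (n : ℕ) :
    (n : ℝ) ^ β + min β 1 * (((n : ℝ) + 1) ^ β / (n + 1)) ≤ ((n : ℝ) + 1) ^ β := by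
  have hn : (0 : ℝ) < n + 1 := n.cast_add_one_pos
  have hinv : ((n : ℝ) + 1)⁻¹ ≤ 1 := inv_le_one_of_one_le₀ (by simp)
  have hquot : ((n : ℝ) / (n + 1)) ^ β ≤ 1 - min β 1 * (n + 1 : ℝ)⁻¹ := by
    have hsub : (n : ℝ) / (n + 1) = 1 + -(n + 1 : ℝ)⁻¹ := by field_simp; ring
    obtain h | h := le_total β 1
    · rw [min_eq_left h, hsub]
      exact (rpow_one_add_le_one_add_mul_self (by linarith) hβ h).trans_eq (by ring)
    · rw [min_eq_right h]
      refine (Real.rpow_le_rpow_of_exponent_ge' (by positivity) ?_ zero_le_one h).trans_eq ?_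
      · rw [div_le_one hn]; linarith
      · rw [Real.rpow_one, hsub]; ring
  rw [Real.div_rpow n.cast_nonneg hn.le, div_le_iff₀ (by positivity)] at hquot
  linear_combination hquot

theorem isBigO_rpow_of_le_add {β : ℝ} (hβ : 0 < β) {r s : ℕ → ℝ} (hr : ∀ n, 0 ≤ r n)
    (hrs : ∀ᶠ n in atTop, r (n + 1) ≤ r n + s n)
    (hs : s =O[atTop] fun n : ℕ => ((n : ℝ) + 1) ^ β / (n + 1)) :
    r =O[atTop] fun n : ℕ => (n : ℝ) ^ β := by
  obtain ⟨C, hC⟩ := hs.bound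
  obtain ⟨N, hN⟩ := eventually_atTop.1 ((hC.and hrs).and (eventually_ge_atTop 1))
  have hγ : 0 < min β 1 := lt_min hβ one_pos
  set K := max (C / min β 1) (r N)
  have hCK : C ≤ K * min β 1 := (div_le_iff₀ hγ).1 (le_max_left _ _)
  have hK0 : 0 ≤ K := (hr N).trans (le_max_right _ _)
  have hbound : ∀ n, N ≤ n → r n ≤ K * (n : ℝ) ^ β := fun n hn => by
    induction n, hn using Nat.le_induction with
    | base =>
      exact (le_max_right _ _).trans (le_mul_of_one_le_right hK0
        (Real.one_le_rpow (by exact_mod_cast (hN N le_rfl).2) hβ.le))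
    | succ n hn ih =>
      obtain ⟨⟨hsn, hrn⟩, -⟩ := hN n hn
      have hpos : (0 : ℝ) ≤ ((n : ℝ) + 1) ^ β / (n + 1) := by positivity
      rw [Real.norm_of_nonneg hpos] at hsn
      push_cast
      calc r (n + 1) ≤ r n + s n := hrn
        _ ≤ K * (n : ℝ) ^ β + K * min β 1 * (((n : ℝ) + 1) ^ β / (n + 1)) :=
          add_le_add ih ((Real.le_norm_self _).trans
            (hsn.trans (mul_le_mul_of_nonneg_right hCK hpos)))
        _ = K * ((n : ℝ) ^ β + min β 1 * (((n : ℝ) + 1) ^ β / (n + 1))) := by ring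
        _ ≤ K * ((n : ℝ) + 1) ^ β :=
          mul_le_mul_of_nonneg_left (rpow_add_min_one_mul_div_le hβ.le n) hK0
  refine IsBigO.of_bound K ((eventually_ge_atTop N).mono fun n hn => ?_)
  rw [Real.norm_of_nonneg (hr n), Real.norm_of_nonneg (by positivity)]
  exact hbound n hn

variable {E : Type*} [NormedAddCommGroup E] [NormedSpace ℝ E]

theorem norm_sub_add_smul_sub_le {P : E →ₗ[ℝ] E} (hP : ∀ y, ‖P y‖ ≤ ‖y‖) {a : ℝ}
    (ha : a ∈ Set.Icc (0 : ℝ) 1) (u l : E) :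
    ‖u + a • (P u - u) - l‖ ≤ ‖u - l‖ + 2 * (a * ‖l‖) := by
  obtain ⟨ha0, ha1⟩ := ha
  have hsplit : u + a • (P u - u) - l = (1 - a) • (u - l) + a • P (u - l) + a • (P l - l) := by
    rw [map_sub]; module
  have hmove : ‖P l - l‖ ≤ 2 * ‖l‖ := (norm_sub_le _ _).trans (by linarith [hP l])
  calc ‖u + a • (P u - u) - l‖
      ≤ ‖(1 - a) • (u - l)‖ + ‖a • P (u - l)‖ + ‖a • (P l - l)‖ := hsplit ▸ norm_add₃_le
    _ = (1 - a) * ‖u - l‖ + a * ‖P (u - l)‖ + a * ‖P l - l‖ := by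
      rw [norm_smul_of_nonneg (sub_nonneg.2 ha1), norm_smul_of_nonneg ha0,
        norm_smul_of_nonneg ha0]
    _ ≤ (1 - a) * ‖u - l‖ + a * ‖u - l‖ + a * (2 * ‖l‖) := by gcongr; exact hP _
    _ = ‖u - l‖ + 2 * (a * ‖l‖) := by ring

theorem isBigO_rpow_of_contracting_recursion {P : E →ₗ[ℝ] E} (hP : ∀ y, ‖P y‖ ≤ ‖y‖) {β : ℝ}
    (hβ : 0 < β) {a : ℕ → ℝ} (ha : ∀ᶠ n in atTop, a n ∈ Set.Icc (0 : ℝ) 1)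
    (haO : a =O[atTop] fun n : ℕ => ((n : ℝ) + 1)⁻¹) {u L : ℕ → E}
    (hL : L =O[atTop] fun n : ℕ => (n : ℝ) ^ β)
    (hu : ∀ᶠ n in atTop, u (n + 1) = u n + a n • (P (u n) - u n) + (L (n + 1) - L n)) :
    u =O[atTop] fun n : ℕ => (n : ℝ) ^ β := by
  -- `L` need not have small increments, but `u - L` is only perturbed by the drift `a • (P L - L)`.
  have hstep : ∀ᶠ n in atTop, ‖u (n + 1) - L (n + 1)‖ ≤ ‖u n - L n‖ + 2 * (a n * ‖L n‖) := by
    filter_upwards [ha, hu] with n han hun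
    convert norm_sub_add_smul_sub_le hP han (u n) (L n) using 2
    rw [hun]
    abel
  have hshift : (fun n : ℕ => (n : ℝ) ^ β) =O[atTop] fun n : ℕ => ((n : ℝ) + 1) ^ β :=
    IsBigO.of_bound' (.of_forall fun n => by
      rw [Real.norm_of_nonneg (by positivity), Real.norm_of_nonneg (by positivity)]
      gcongr
      linarith)
  have hnoise : (fun n => 2 * (a n * ‖L n‖)) =O[atTop]
      fun n : ℕ => ((n : ℝ) + 1) ^ β / (n + 1) := by
    simp only [div_eq_inv_mul]
    exact (haO.mul (hL.norm_left.trans hshift)).const_mul_left 2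
  have hdiff : (fun n => ‖u n - L n‖) =O[atTop] fun n : ℕ => (n : ℝ) ^ β :=
    isBigO_rpow_of_le_add hβ (fun n => norm_nonneg (u n - L n)) hstep hnoise
  simpa only [sub_add_cancel] using hdiff.of_norm_left.add hL

theorem isLittleO_rpow_rpow_atTop {a b : ℝ} (hab : a < b) :
    (fun x : ℝ => x ^ a) =o[atTop] fun x : ℝ => x ^ b := by
  refine (isLittleO_iff_tendsto' ?_).2 ((tendsto_rpow_neg_atTop (sub_pos.2 hab)).congr' ?_)
  · filter_upwards [eventually_gt_atTop 0] with x hx hxb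
    exact absurd hxb (Real.rpow_pos_of_pos hx b).ne'
  · filter_upwards [eventually_gt_atTop 0] with x hx
    rw [← Real.rpow_sub hx, neg_sub]

theorem isLittleO_abs_div_sub_of_isBigO_sub {N : ℕ → ℝ} {ρ : ℝ}
    (h : ∀ β : ℝ, 1 / 2 < β → (fun n : ℕ => N n - n * ρ) =O[atTop] fun n : ℕ => (n : ℝ) ^ β)
    {δ : ℝ} (hδ : 0 < δ) :
    (fun n : ℕ => |N n / n - ρ|) =o[atTop] fun n : ℕ => (n : ℝ) ^ (-(1 / 2 : ℝ) + δ) := by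
  have hdiv : (fun n : ℕ => (N n - n * ρ) * (n : ℝ)⁻¹) =O[atTop]
      fun n : ℕ => (n : ℝ) ^ (1 / 2 + δ / 2) * (n : ℝ)⁻¹ :=
    (h (1 / 2 + δ / 2) (by linarith)).mul (isBigO_refl _ _)
  have hexp : (fun n : ℕ => (n : ℝ) ^ (-(1 / 2 : ℝ) + δ / 2)) =o[atTop]
      fun n : ℕ => (n : ℝ) ^ (-(1 / 2 : ℝ) + δ) :=
    (isLittleO_rpow_rpow_atTop (by linarith)).comp_tendsto tendsto_natCast_atTop_atTop
  refine IsBigO.trans_isLittleO (IsBigO.abs_left (hdiv.congr' ?_ ?_)) hexp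
  · filter_upwards [eventually_ne_atTop 0] with n hn
    field_simp
  · filter_upwards [eventually_gt_atTop 0] with n hn
    rw [← Real.rpow_neg_one, ← Real.rpow_add (Nat.cast_pos.2 hn)]
    ring_nf

theorem tendsto_div_of_isBigO_sub {N : ℕ → ℝ} {ρ : ℝ}
    (h : ∀ β : ℝ, 1 / 2 < β → (fun n : ℕ => N n - n * ρ) =O[atTop] fun n : ℕ => (n : ℝ) ^ β) :
    Tendsto (fun n : ℕ => N n / n) atTop (𝓝 ρ) := by
  have hone := isLittleO_abs_div_sub_of_isBigO_sub h one_half_pos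
  rw [neg_add_cancel] at hone
  simp only [Real.rpow_zero] at hone
  exact tendsto_sub_nhds_zero_iff.1 ((isLittleO_one_iff ℝ).1 hone.of_abs_left)

end Growth

section FeedbackShift

variable {p : ℕ}

/-- The linear map which shifts the entries of a vector by one place, dropping the last one, and
fills the first place with the combination of all entries with coefficients `w`. Both the mean
motion of the degree counts and its averaging form are of this kind. -/
def feedbackShift (w : Fin (p + 1) → ℝ) : (Fin (p + 1) → ℝ) →ₗ[ℝ] Fin (p + 1) → ℝ where
  toFun v := Fin.cons (∑ i, w i * v i) (Fin.init v)
  map_add' u v := by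
    ext i
    cases i using Fin.cases with
    | zero => simp [mul_add, Finset.sum_add_distrib]
    | succ i => simp [Fin.init]
  map_smul' c v := by
    ext i
    cases i using Fin.cases with
    | zero => simp [mul_left_comm, Finset.mul_sum]
    | succ i => simp [Fin.init]

theorem feedbackShift_zero (w v : Fin (p + 1) → ℝ) : feedbackShift w v 0 = ∑ i, w i * v i := rfl

theorem feedbackShift_succ (w v : Fin (p + 1) → ℝ) (i : Fin p) :
    feedbackShift w v i.succ = v i.castSucc := rfl

theorem norm_feedbackShift_le {w : Fin (p + 1) → ℝ} (hw : ∀ i, 0 ≤ w i) (hsum : ∑ i, w i ≤ 1)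
    (v : Fin (p + 1) → ℝ) : ‖feedbackShift w v‖ ≤ ‖v‖ := by
  refine (pi_norm_le_iff_of_nonneg (norm_nonneg v)).2 fun i => ?_
  cases i using Fin.cases with
  | zero =>
    calc ‖∑ i, w i * v i‖ ≤ ∑ i, w i * ‖v‖ := norm_sum_le_of_le _ fun i _ => by
          rw [norm_mul, Real.norm_of_nonneg (hw i)]
          exact mul_le_mul_of_nonneg_left (norm_le_pi_norm v i) (hw i)
      _ = (∑ i, w i) * ‖v‖ := (Finset.sum_mul _ _ _).symm
      _ ≤ ‖v‖ := mul_le_of_le_one_left (norm_nonneg v) hsum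
  | succ i => exact norm_le_pi_norm v i.castSucc

theorem feedbackShift_eq_feedbackShift {w w' v : Fin (p + 1) → ℝ}
    (h : ∑ i, w i * v i = ∑ i, w' i * v i) : feedbackShift w v = feedbackShift w' v :=
  congrArg (fun t => Fin.cons (α := fun _ => ℝ) t (Fin.init v)) h

/-- The geometric vector with ratio `r`, normalised so that its partial sums are `1 - r ^ k`. -/
def geometricProfile (p : ℕ) (r : ℝ) (i : Fin (p + 1)) : ℝ := (1 - r) * r ^ (i : ℕ)

/-- The total number of steps which particles at the places `0, …, p`, with multiplicities `v`,
need to leave through the last place. -/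
def totalDeficit (p : ℕ) : (Fin (p + 1) → ℝ) →ₗ[ℝ] ℝ :=
  ∑ i : Fin (p + 1), ((p : ℝ) + 1 - (i : ℕ)) • LinearMap.proj i

theorem totalDeficit_apply (v : Fin (p + 1) → ℝ) :
    totalDeficit p v = ∑ i : Fin (p + 1), ((p : ℝ) + 1 - (i : ℕ)) * v i := by
  simp [totalDeficit]

theorem sum_geometricProfile (p : ℕ) (r : ℝ) : ∑ i, geometricProfile p r i = 1 - r ^ (p + 1) := by
  simp only [geometricProfile]
  rw [← Finset.mul_sum, Fin.sum_univ_eq_sum_range (fun i => r ^ i), mul_neg_geom_sum]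

theorem totalDeficit_geometricProfile (p : ℕ) (r : ℝ) :
    totalDeficit p (geometricProfile p r) = p + 1 - ∑ i : Fin (p + 1), r ^ (i + 1 : ℕ) := by
  rw [totalDeficit_apply, Fin.sum_univ_eq_sum_range (fun i => r ^ (i + 1))]
  simp only [geometricProfile]
  rw [Fin.sum_univ_eq_sum_range (fun i => ((p : ℝ) + 1 - i) * ((1 - r) * r ^ i))]
  induction p with
  | zero => simp
  | succ p ih =>
    rw [Finset.sum_range_succ, Finset.sum_range_succ _ (p + 1)]
    have hgeom := mul_neg_geom_sum r (p + 1)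
    have hsplit : ∑ i ∈ Finset.range (p + 1), (((p + 1 : ℕ) : ℝ) + 1 - i) * ((1 - r) * r ^ i) =
        ∑ i ∈ Finset.range (p + 1), ((p : ℝ) + 1 - i) * ((1 - r) * r ^ i) +
          (1 - r) * ∑ i ∈ Finset.range (p + 1), r ^ i := by
      rw [Finset.mul_sum, ← Finset.sum_add_distrib]
      exact Finset.sum_congr rfl fun i _ => by push_cast; ring
    rw [hsplit, ih, hgeom]
    push_cast
    ring

end FeedbackShift

section Root

theorem hasDerivAt_mul_sub_pow (D : ℕ) (c x : ℝ) :
    HasDerivAt (fun x : ℝ => x * (c - x) ^ (D + 1)) ((c - x) ^ D * (c - (D + 2) * x)) x := by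
  refine ((hasDerivAt_id' x).mul (((hasDerivAt_id' x).const_sub c).pow (D + 1))).congr_deriv ?_
  push_cast
  simp only [Pi.pow_apply]
  ring

theorem strictMonoOn_mul_sub_pow (D : ℕ) (c : ℝ) :
    StrictMonoOn (fun x : ℝ => x * (c - x) ^ (D + 1)) (Set.Icc 0 (c / (D + 2))) := by
  refine strictMonoOn_of_deriv_pos (convex_Icc _ _) (by fun_prop) fun x hx => ?_
  rw [interior_Icc] at hx
  obtain ⟨hx0, hxc⟩ := hx
  rw [lt_div_iff₀ (by positivity)] at hxc
  have hDx : 0 ≤ (D : ℝ) * x := by positivity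
  rw [(hasDerivAt_mul_sub_pow D c x).deriv]
  exact mul_pos (pow_pos (by linarith) D) (by linarith)

theorem strictAntiOn_mul_sub_pow (D : ℕ) (c : ℝ) :
    StrictAntiOn (fun x : ℝ => x * (c - x) ^ (D + 1)) (Set.Icc (c / (D + 2)) c) := by
  refine strictAntiOn_of_deriv_neg (convex_Icc _ _) (by fun_prop) fun x hx => ?_
  rw [interior_Icc] at hx
  obtain ⟨hcx, hxc⟩ := hx
  rw [div_lt_iff₀ (by positivity)] at hcx
  rw [(hasDerivAt_mul_sub_pow D c x).deriv]
  exact mul_neg_of_pos_of_neg (pow_pos (by linarith) D) (by linarith)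

theorem existsUnique_mul_sub_pow_eq {D : ℕ} {b c : ℝ} (hc : 1 < c) (hcb : c / (D + 2) ≤ b)
    (hb : b < 1) :
    ∃! x : ℝ, x ∈ Set.Ioo 0 b ∧ x * (c - x) ^ (D + 1) = (c - 1) ^ (D + 1) := by
  set f : ℝ → ℝ := fun x => x * (c - x) ^ (D + 1) with hf
  have hpeak : 0 ≤ c / (D + 2) := by positivity
  -- `x = 1` solves the equation, on the decreasing branch of `f`.
  have habove (y : ℝ) (hy : c / (D + 2) ≤ y) (hy1 : y < 1) : (c - 1) ^ (D + 1) < f y := by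
    simpa [hf] using strictAntiOn_mul_sub_pow D c ⟨hy, by linarith⟩
      ⟨hy.trans hy1.le, hc.le⟩ hy1
  have hbelow : f 0 < (c - 1) ^ (D + 1) := by
    simpa [hf] using pow_pos (sub_pos.2 hc) (D + 1)
  obtain ⟨x, hx, hfx⟩ := intermediate_value_Ioo hpeak (f := f) (by fun_prop)
    ⟨hbelow, habove _ le_rfl (by linarith)⟩
  refine ⟨x, ⟨⟨hx.1, hx.2.trans_le hcb⟩, hfx⟩, fun y ⟨hy, hfy⟩ => ?_⟩
  have hyp : y < c / (D + 2) := by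
    by_contra! h
    exact (habove y h (hy.2.trans hb)).ne' hfy
  exact (strictMonoOn_mul_sub_pow D c).injOn ⟨hy.1.le, hyp.le⟩ ⟨hx.1.le, hx.2.le⟩
    (hfy.trans hfx.symm)

end Root

section EulerLotka

variable {p : ℕ} {m r : ℝ}

/-- The defect of `v` in the eigenvector equation `r • S v = v` for the uniform feedback shift
`S = feedbackShift fun _ => m⁻¹`. -/
noncomputable def eigenDefect (p : ℕ) (m r : ℝ) : (Fin (p + 1) → ℝ) →ₗ[ℝ] Fin (p + 1) → ℝ :=
  r • feedbackShift (fun _ => m⁻¹) - LinearMap.id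

theorem eigenDefect_zero (v : Fin (p + 1) → ℝ) :
    eigenDefect p m r v 0 = r * (m⁻¹ * ∑ i, v i) - v 0 := by
  simp [eigenDefect, feedbackShift_zero, Finset.mul_sum]

theorem eigenDefect_succ (v : Fin (p + 1) → ℝ) (i : Fin p) :
    eigenDefect p m r v i.succ = r * v i.castSucc - v i.succ := by
  simp [eigenDefect, feedbackShift_succ]

theorem eigenDefect_feedbackShift (v : Fin (p + 1) → ℝ) :
    eigenDefect p m r (feedbackShift (fun _ => m⁻¹) v) =
      feedbackShift (fun _ => m⁻¹) (eigenDefect p m r v) := by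
  simp [eigenDefect]

theorem one_sub_mul_sum_pow_succ (p : ℕ) (r : ℝ) :
    (1 - r) * ∑ i : Fin (p + 1), r ^ (i + 1 : ℕ) = r * (1 - r ^ (p + 1)) := by
  rw [← mul_neg_geom_sum, Fin.sum_univ_eq_sum_range (fun i => r ^ (i + 1))]
  simp only [pow_succ, ← Finset.sum_mul]
  ring

theorem eigenDefect_geometricProfile (hm : m ≠ 0)
    (h : ∑ i : Fin (p + 1), r ^ (i + 1 : ℕ) = m) :
    eigenDefect p m r (geometricProfile p r) = 0 := by
  ext i
  cases i using Fin.cases with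
  | zero =>
    rw [eigenDefect_zero, sum_geometricProfile, mul_left_comm, ← one_sub_mul_sum_pow_succ, h,
      mul_comm _ m, inv_mul_cancel_left₀ hm]
    simp [geometricProfile]
  | succ i =>
    simp [eigenDefect_succ, geometricProfile]
    ring

/-- The coefficients form the left eigenvector of `r • S` for the eigenvalue one. -/
theorem sum_one_sub_pow_mul_eigenDefect (hm : m ≠ 0)
    (h : ∑ i : Fin (p + 1), r ^ (i + 1 : ℕ) = m) (v : Fin (p + 1) → ℝ) :
    ∑ i : Fin (p + 1), (1 - r ^ (p + 1 - i : ℕ)) * eigenDefect p m r v i = 0 := by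
  set c : ℕ → ℝ := fun i => 1 - r ^ (p + 1 - i) with hc
  have hfirst : c 0 * (r * m⁻¹) = 1 - r := by
    rw [← mul_assoc, ← div_eq_mul_inv, div_eq_iff hm, mul_comm (c 0), ← h]
    exact (one_sub_mul_sum_pow_succ p r).symm
  have hnext (i : Fin (p + 1)) : 1 - r - c i + r * c (i + 1) = 0 := by
    have hi : p + 1 - (i : ℕ) = p + 1 - (i + 1) + 1 := by omega
    simp only [hc, hi, pow_succ]
    ring
  have hlast : c (p + 1) = 0 := by simp [hc]
  calc ∑ i : Fin (p + 1), c i * eigenDefect p m r v i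
      = c 0 * (r * m⁻¹) * ∑ i, v i - ∑ i : Fin (p + 1), c i * v i
          + ∑ i : Fin (p + 1), r * c (i + 1) * v i := by
        rw [Fin.sum_univ_succ, Fin.sum_univ_succ fun i : Fin (p + 1) => c i * v i,
          Fin.sum_univ_castSucc fun i : Fin (p + 1) => r * c (i + 1) * v i]
        simp only [eigenDefect_zero, eigenDefect_succ, mul_sub, Finset.sum_sub_distrib,
          Fin.val_zero, Fin.val_succ, Fin.val_castSucc, Fin.val_last, hlast, mul_zero, zero_mul,
          mul_left_comm (c _) r, ← mul_assoc]
        ring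
    _ = ∑ i : Fin (p + 1), (1 - r - c i + r * c (i + 1)) * v i := by
        simp only [hfirst, add_mul, sub_mul, Finset.sum_add_distrib, Finset.sum_sub_distrib,
          Finset.mul_sum]
    _ = 0 := Finset.sum_eq_zero fun i _ => by rw [hnext, zero_mul]

theorem feedbackShift_eigenDefect (hm : m ≠ 0) (h : ∑ i : Fin (p + 1), r ^ (i + 1 : ℕ) = m)
    (v : Fin (p + 1) → ℝ) :
    feedbackShift (fun _ => m⁻¹) (eigenDefect p m r v) =
      feedbackShift (fun i => m⁻¹ * r ^ (p + 1 - i : ℕ)) (eigenDefect p m r v) := by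
  refine feedbackShift_eq_feedbackShift (sub_eq_zero.1 ?_)
  rw [← Finset.sum_sub_distrib, ← mul_zero m⁻¹, ← sum_one_sub_pow_mul_eigenDefect hm h v,
    Finset.mul_sum]
  exact Finset.sum_congr rfl fun i _ => by ring

theorem norm_feedbackShift_pow_le (hr : 0 ≤ r) (hm : m ≠ 0)
    (h : ∑ i : Fin (p + 1), r ^ (i + 1 : ℕ) = m) (v : Fin (p + 1) → ℝ) :
    ‖feedbackShift (fun i => m⁻¹ * r ^ (p + 1 - i : ℕ)) v‖ ≤ ‖v‖ := by
  have hm0 : 0 ≤ m := h ▸ Finset.sum_nonneg fun i _ => pow_nonneg hr _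
  refine norm_feedbackShift_le (fun i => by positivity) (le_of_eq ?_) v
  calc ∑ i : Fin (p + 1), m⁻¹ * r ^ (p + 1 - i : ℕ)
      = m⁻¹ * ∑ i : Fin (p + 1), r ^ (Fin.rev i + 1 : ℕ) := by
        rw [Finset.mul_sum]
        exact Finset.sum_congr rfl fun i _ => by
          rw [Fin.val_rev, show p + 1 - (i + 1) + 1 = p + 1 - (i : ℕ) by omega]
    _ = m⁻¹ * ∑ i : Fin (p + 1), r ^ (i + 1 : ℕ) :=
        congrArg _ (Equiv.sum_comp Fin.revPerm fun i : Fin (p + 1) => r ^ (i + 1 : ℕ))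
    _ = 1 := by rw [h, inv_mul_cancel₀ hm]

theorem injective_eigenDefect_prod_totalDeficit (hr : 0 ≤ r) :
    Function.Injective ((eigenDefect p m r).prod (totalDeficit p)) := by
  rw [← LinearMap.ker_eq_bot, LinearMap.ker_eq_bot']
  intro v hv
  obtain ⟨hdefect, hdeficit⟩ := Prod.mk_eq_zero.1 hv
  have hgeom (i : Fin (p + 1)) : v i = v 0 * r ^ (i : ℕ) := by
    induction i using Fin.induction with
    | zero => simp
    | succ i ih =>
      have hi := congrFun hdefect i.succ
      rw [eigenDefect_succ, Pi.zero_apply, sub_eq_zero, ih] at hi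
      rw [← hi, Fin.val_succ, Fin.val_castSucc, pow_succ]
      ring
  have hpos : 0 < ∑ i : Fin (p + 1), ((p : ℝ) + 1 - (i : ℕ)) * r ^ (i : ℕ) := by
    have hle (i : Fin (p + 1)) : ((i : ℕ) : ℝ) ≤ p := by exact_mod_cast i.is_le
    refine Finset.sum_pos' (fun i _ => mul_nonneg (by linarith [hle i]) (by positivity))
      ⟨0, Finset.mem_univ _, ?_⟩
    simp only [Fin.val_zero, pow_zero, Nat.cast_zero, sub_zero, mul_one]
    positivity
  have hzero : v 0 = 0 := by
    refine (mul_eq_zero.1 ?_).resolve_right hpos.ne'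
    rw [← hdeficit, totalDeficit_apply, Finset.mul_sum]
    exact Finset.sum_congr rfl fun i _ => by rw [hgeom i]; ring
  exact funext fun i => by rw [hgeom i, hzero, zero_mul, Pi.zero_apply]

theorem isBigO_eigenDefect (hr : 0 ≤ r) (hm : m ≠ 0)
    (h : ∑ i : Fin (p + 1), r ^ (i + 1 : ℕ) = m) {β : ℝ} (hβ : 0 < β) {a : ℕ → ℝ}
    (ha : ∀ᶠ n in atTop, a n ∈ Set.Icc (0 : ℝ) 1)
    (haO : a =O[atTop] fun n : ℕ => ((n : ℝ) + 1)⁻¹) {v L : ℕ → Fin (p + 1) → ℝ}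
    (hL : L =O[atTop] fun n : ℕ => (n : ℝ) ^ β)
    (hv : ∀ᶠ n in atTop, v (n + 1) =
      v n + a n • (feedbackShift (fun _ => m⁻¹) (v n) - v n) + (L (n + 1) - L n)) :
    (fun n => eigenDefect p m r (v n)) =O[atTop] fun n : ℕ => (n : ℝ) ^ β := by
  refine isBigO_rpow_of_contracting_recursion (norm_feedbackShift_pow_le hr hm h) hβ ha haO
    (((eigenDefect p m r).toContinuousLinearMap.isBigO_comp L atTop).trans hL) ?_
  filter_upwards [hv] with n hn
  simp only [LinearMap.coe_toContinuousLinearMap', hn, map_add, map_sub, map_smul,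
    eigenDefect_feedbackShift, feedbackShift_eigenDefect hm h]

theorem isBigO_sub_smul_geometricProfile (hr : 0 ≤ r) (hm : m ≠ 0)
    (h : ∑ i : Fin (p + 1), r ^ (i + 1 : ℕ) = m) {β : ℝ} (hβ : 0 < β) {a : ℕ → ℝ}
    (ha : ∀ᶠ n in atTop, a n ∈ Set.Icc (0 : ℝ) 1)
    (haO : a =O[atTop] fun n : ℕ => ((n : ℝ) + 1)⁻¹) {v L : ℕ → Fin (p + 1) → ℝ}
    (hL : L =O[atTop] fun n : ℕ => (n : ℝ) ^ β)
    (hv : ∀ᶠ n in atTop, v (n + 1) =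
      v n + a n • (feedbackShift (fun _ => m⁻¹) (v n) - v n) + (L (n + 1) - L n))
    {C : ℝ} (hC : ∀ᶠ n : ℕ in atTop, totalDeficit p (v n) = (p + 1 - m) * n + C) :
    (fun n : ℕ => v n - (n : ℝ) • geometricProfile p r) =O[atTop] fun n : ℕ => (n : ℝ) ^ β := by
  have hdefect : (fun n : ℕ => eigenDefect p m r (v n - (n : ℝ) • geometricProfile p r))
      =O[atTop] fun n : ℕ => (n : ℝ) ^ β := by
    simpa only [map_sub, map_smul, eigenDefect_geometricProfile hm h, smul_zero, sub_zero] using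
      isBigO_eigenDefect hr hm h hβ ha haO hL hv
  have hdeficit : (fun n : ℕ => totalDeficit p (v n - (n : ℝ) • geometricProfile p r))
      =O[atTop] fun n : ℕ => (n : ℝ) ^ β := by
    have hconst : (fun _ : ℕ => C) =O[atTop] fun n : ℕ => (n : ℝ) ^ β :=
      (isLittleO_const_left.2 <| .inr <| tendsto_norm_atTop_atTop.comp <|
        (tendsto_rpow_atTop hβ).comp tendsto_natCast_atTop_atTop).isBigO
    refine hconst.congr' (hC.mono fun n hn => ?_) .rfl
    simp only [map_sub, map_smul, hn, totalDeficit_geometricProfile, h, smul_eq_mul]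
    ring
  obtain ⟨K, -, hK⟩ := LinearMap.exists_antilipschitzWith _
    (LinearMap.ker_eq_bot.2 (injective_eigenDefect_prod_totalDeficit (p := p) (m := m) hr))
  exact (IsBigO.of_bound K (.of_forall fun n => hK.le_mul_norm (map_zero _) _)).trans
    (hdefect.prod_left hdeficit)

end EulerLotka

section TopRoot

variable {m d : ℕ} {x : ℝ}

theorem two_mul_div_lt_one (hd : 2 * m < d) : (2 * m / d : ℝ) < 1 := by
  rw [div_lt_one (by exact_mod_cast (by omega : 0 < d))]
  exact_mod_cast hd

theorem isTopRoot_iff_mul_pow_eq (hd : 2 * m < d) :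
    IsTopRoot m d x ↔ x ∈ Set.Ioo (0 : ℝ) (2 * m / d) ∧
      x * ((m : ℝ) + 1 - x) ^ (d - m) = (m : ℝ) ^ (d - m) := by
  refine and_congr_right fun hx => ?_
  have hpos : (0 : ℝ) < m + 1 - x := by
    linarith [hx.2.trans (two_mul_div_lt_one hd), m.cast_nonneg (α := ℝ)]
  rw [div_pow, div_eq_iff (by positivity), eq_comm]

theorem existsUnique_isTopRoot (hm : 1 ≤ m) (hd : 2 * m < d) : ∃! x : ℝ, IsTopRoot m d x := by
  obtain ⟨D, rfl⟩ : ∃ D, d = m + (D + 1) := Nat.exists_eq_add_of_lt (by omega : m < d)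
  have hm1 : (1 : ℝ) ≤ m := by exact_mod_cast hm
  have hmD : (m : ℝ) ≤ D := by exact_mod_cast (by omega : m ≤ D)
  have hpeak : ((m : ℝ) + 1) / (D + 2) ≤ 2 * m / (m + (D + 1) : ℕ) := by
    push_cast
    rw [div_le_div_iff₀ (by positivity) (by positivity)]
    nlinarith
  simp only [isTopRoot_iff_mul_pow_eq hd, Nat.add_sub_cancel_left]
  simpa only [add_sub_cancel_right] using
    existsUnique_mul_sub_pow_eq (by linarith) hpeak (two_mul_div_lt_one hd)

namespace IsTopRoot

theorem lt_one (hd : 2 * m < d) (h : IsTopRoot m d x) : x < 1 :=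
  h.1.2.trans (two_mul_div_lt_one hd)

theorem add_one_sub_pos (hd : 2 * m < d) (h : IsTopRoot m d x) : (0 : ℝ) < m + 1 - x := by
  linarith [h.lt_one hd, m.cast_nonneg (α := ℝ)]

theorem one_sub_div_eq (hd : 2 * m < d) (h : IsTopRoot m d x) :
    1 - (m : ℝ) / (m + 1 - x) = (1 - x) / (m + 1 - x) := by
  have := h.add_one_sub_pos hd
  field_simp
  ring

theorem limitProportion_eq_geometricProfile {p : ℕ} (hd : 2 * m < m + p + 1)
    (h : IsTopRoot m (m + p + 1) x) (i : Fin (p + 1)) :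
    limitProportion m (m + p + 1) x (m + i) = geometricProfile p (m / (m + 1 - x)) i := by
  rw [limitProportion, if_neg (by omega), Nat.add_sub_cancel_left, geometricProfile,
    h.one_sub_div_eq hd, div_pow, div_mul_div_comm, pow_succ']

theorem pow_succ_eq {p : ℕ} (h : IsTopRoot m (m + p + 1) x) :
    ((m : ℝ) / (m + 1 - x)) ^ (p + 1) = x := by
  simpa only [add_assoc, Nat.add_sub_cancel_left] using h.2

theorem sum_pow_succ_eq {p : ℕ} (hd : 2 * m < m + p + 1) (h : IsTopRoot m (m + p + 1) x) :
    ∑ i : Fin (p + 1), ((m : ℝ) / (m + 1 - x)) ^ (i + 1 : ℕ) = m := by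
  have hratio : 1 - (m : ℝ) / (m + 1 - x) ≠ 0 :=
    h.one_sub_div_eq hd ▸ (div_pos (sub_pos.2 (h.lt_one hd)) (h.add_one_sub_pos hd)).ne'
  refine mul_left_cancel₀ hratio ?_
  rw [one_sub_mul_sum_pow_succ, h.pow_succ_eq, h.one_sub_div_eq hd]
  ring

end IsTopRoot

end TopRoot

section Graph

open scoped Classical

variable {n : ℕ} (G : SimpleGraph (Fin n)) (S : Finset (Fin n))

theorem addVertex_adj_castSucc (u v : Fin n) :
    (addVertex G S).Adj u.castSucc v.castSucc ↔ G.Adj u v := by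
  simpa [addVertex, SimpleGraph.map_adj', Fin.castSucc_ne_last] using fun h : G.Adj u v => h.ne

theorem addVertex_adj_last (v : Fin n) :
    (addVertex G S).Adj (Fin.last n) v.castSucc ↔ v ∈ S := by
  simp [addVertex, SimpleGraph.map_adj', Fin.castSucc_ne_last, (Fin.castSucc_ne_last v).symm]

theorem addVertex_injective : Function.Injective (addVertex G) := by
  intro S T h
  ext v
  rw [← addVertex_adj_last G S, ← addVertex_adj_last G T, h]

theorem degree_addVertex_castSucc (v : Fin n) :
    (addVertex G S).degree v.castSucc = G.degree v + if v ∈ S then 1 else 0 := by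
  have h := (addVertex G S).degree_eq_sum_if_adj (R := ℕ) v.castSucc
  rw [Fin.sum_univ_castSucc] at h
  simpa only [addVertex_adj_castSucc, SimpleGraph.adj_comm _ v.castSucc (Fin.last n),
    addVertex_adj_last, ← SimpleGraph.degree_eq_sum_if_adj, Nat.cast_id] using h

theorem degree_addVertex_last : (addVertex G S).degree (Fin.last n) = S.card := by
  have h := (addVertex G S).degree_eq_sum_if_adj (R := ℕ) (Fin.last n)
  rw [Fin.sum_univ_castSucc] at h
  simpa [addVertex_adj_last] using h

theorem sum_degree_addVertex {R : Type*} [AddCommGroup R] (g : ℕ → R) :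
    ∑ v, g ((addVertex G S).degree v) =
      ∑ v, g (G.degree v) + g S.card + ∑ v ∈ S, (g (G.degree v + 1) - g (G.degree v)) := by
  have hg (v : Fin n) : g ((addVertex G S).degree v.castSucc) = g (G.degree v) +
      if v ∈ S then g (G.degree v + 1) - g (G.degree v) else 0 := by
    rw [degree_addVertex_castSucc]
    split_ifs <;> simp
  rw [Fin.sum_univ_castSucc, degree_addVertex_last, Finset.sum_congr rfl fun v _ => hg v,
    Finset.sum_add_distrib, ← Finset.sum_filter, Finset.filter_univ_mem]
  abel

theorem numDegree_eq_sum (k : ℕ) :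
    (numDegree k G : ℝ) = ∑ v, if G.degree v = k then 1 else 0 := by
  rw [Finset.sum_boole, numDegree]

theorem abs_numDegree_addVertex_sub_le (k : ℕ) :
    |(numDegree k (addVertex G S) : ℝ) - numDegree k G| ≤ S.card + 1 := by
  have hS : |∑ v ∈ S, ((if G.degree v + 1 = k then (1 : ℝ) else 0) -
      if G.degree v = k then 1 else 0)| ≤ S.card := by
    refine (Finset.abs_sum_le_sum_abs _ _).trans ?_
    refine (Finset.sum_le_card_nsmul _ _ 1 fun v _ => ?_).trans (by simp)
    split_ifs <;> simp
  have hnew : |(if S.card = k then (1 : ℝ) else 0)| ≤ 1 := by split_ifs <;> simp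
  rw [numDegree_eq_sum, numDegree_eq_sum,
    sum_degree_addVertex G S fun j => if j = k then (1 : ℝ) else 0, add_assoc, add_sub_cancel_left]
  exact (abs_add_le _ _).trans (by linarith)

variable {G} in
theorem mem_eligibleVertices {d : ℕ} {v : Fin n} : v ∈ eligibleVertices d G ↔ G.degree v < d := by
  simp [eligibleVertices]

theorem degree_top_fin (v : Fin n) [Fintype ((⊤ : SimpleGraph (Fin n)).neighborSet v)] :
    (⊤ : SimpleGraph (Fin n)).degree v = n - 1 := by
  convert SimpleGraph.complete_graph_degree v
  simp

variable {G} in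
theorem sum_eligibleVertices_degree {m d : ℕ} (hG : ∀ v, m ≤ G.degree v) (g : ℕ → ℝ) :
    ∑ v ∈ eligibleVertices d G, g (G.degree v) = ∑ k ∈ Finset.Ico m d, numDegree k G * g k := by
  rw [← Finset.sum_fiberwise_of_maps_to (t := Finset.Ico m d) (g := fun v => G.degree v)
    fun v hv => Finset.mem_Ico.2 ⟨hG v, mem_eligibleVertices.1 hv⟩]
  refine Finset.sum_congr rfl fun k hk => ?_
  have hfilter : (eligibleVertices d G).filter (G.degree · = k) =
      Finset.univ.filter (G.degree · = k) := by
    ext v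
    simp only [Finset.mem_filter, mem_eligibleVertices, Finset.mem_univ, true_and,
      and_iff_right_iff_imp]
    rintro rfl
    exact (Finset.mem_Ico.1 hk).2
  rw [hfilter, Finset.sum_congr rfl fun v hv => congrArg g (Finset.mem_filter.1 hv).2,
    Finset.sum_const, nsmul_eq_mul, numDegree]

theorem sum_eligibleVertices_boole {d k : ℕ} (hk : k < d) :
    (∑ v ∈ eligibleVertices d G, if G.degree v = k then (1 : ℝ) else 0) = numDegree k G := by
  rw [numDegree_eq_sum, eligibleVertices, Finset.sum_filter]
  refine Finset.sum_congr rfl fun v _ => ?_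
  split_ifs <;> first | rfl | omega

end Graph

section StepMean

open Finset
open scoped BigOperators

theorem expect_powersetCard_sum {α : Type*} {A : Finset α} {m : ℕ}
    (hA : m ≤ A.card) (f : α → ℝ) :
    (𝔼 S ∈ A.powersetCard m, ∑ v ∈ S, f v) = m / A.card * ∑ v ∈ A, f v := by
  classical
  obtain rfl | hm := m.eq_zero_or_pos
  · simp
  have hswap : ∑ S ∈ A.powersetCard m, ∑ v ∈ S, f v =
      ∑ v ∈ A, ∑ _ ∈ (A.powersetCard m).filter (v ∈ ·), f v := by
    refine sum_comm' fun S v => ?_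
    simp only [mem_filter, mem_powersetCard]
    exact ⟨fun h => ⟨⟨h.1, h.2⟩, h.1.1 h.2⟩, fun h => ⟨h.1.1, h.1.2⟩⟩
  have hcard (v : α) (hv : v ∈ A) :
      ((A.powersetCard m).filter (v ∈ ·)).card = (A.card - 1).choose (m - 1) := by
    simpa using card_filter_powersetCard_subset {v} A m (by simpa using hv) (card_singleton v ▸ hm)
  have hchoose : (A.card : ℝ) * (A.card - 1).choose (m - 1) = A.card.choose m * m := by
    obtain ⟨a, ha⟩ := Nat.exists_eq_add_of_le' (hm.trans_le hA)
    obtain ⟨j, rfl⟩ := Nat.exists_eq_add_of_le' hm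
    rw [ha]
    exact_mod_cast Nat.add_one_mul_choose_eq a j
  have hpos : (0 : ℝ) < A.card.choose m := by exact_mod_cast Nat.choose_pos hA
  have hA0 : (0 : ℝ) < A.card := by exact_mod_cast hm.trans_le hA
  rw [expect_eq_sum_div_card, card_powersetCard, hswap, div_eq_iff hpos.ne',
    sum_congr rfl fun v hv => by rw [sum_const, hcard v hv, nsmul_eq_mul], ← mul_sum]
  field_simp
  linear_combination (∑ v ∈ A, f v) * hchoose

/-- The conditional mean of `φ (G (n + 1))` given that `G n = H`. -/
noncomputable def stepMean (m d : ℕ) {n : ℕ} (φ : SimpleGraph (Fin (n + 1)) → ℝ)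
    (H : SimpleGraph (Fin n)) : ℝ :=
  𝔼 S ∈ (eligibleVertices d H).powersetCard m, φ (addVertex H S)

variable {m d n : ℕ} {H : SimpleGraph (Fin n)}

theorem abs_stepMean_sub_le (hH : m ≤ (eligibleVertices d H).card)
    {φ : SimpleGraph (Fin (n + 1)) → ℝ} {r c : ℝ}
    (h : ∀ S ∈ (eligibleVertices d H).powersetCard m, |φ (addVertex H S) - r| ≤ c) :
    |stepMean m d φ H - r| ≤ c := by
  have hne : ((eligibleVertices d H).powersetCard m).Nonempty := powersetCard_nonempty.2 hH
  rw [stepMean, ← expect_const hne r, ← expect_sub_distrib]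
  exact (abs_expect_le _ _).trans (expect_le hne h)

open scoped Classical in
theorem stepMean_sum_degree (hH : m ≤ (eligibleVertices d H).card) (g : ℕ → ℝ) :
    stepMean m d (fun H' => ∑ v, g (H'.degree v)) H = ∑ v, g (H.degree v) + g m +
      m / (eligibleVertices d H).card *
        ∑ v ∈ eligibleVertices d H, (g (H.degree v + 1) - g (H.degree v)) := by
  have hne : ((eligibleVertices d H).powersetCard m).Nonempty := powersetCard_nonempty.2 hH
  calc stepMean m d (fun H' => ∑ v, g (H'.degree v)) H
      = 𝔼 S ∈ (eligibleVertices d H).powersetCard m, ((∑ v, g (H.degree v) + g m) +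
          ∑ v ∈ S, (g (H.degree v + 1) - g (H.degree v))) :=
        expect_congr rfl fun S hS => by
          beta_reduce
          rw [sum_degree_addVertex, (mem_powersetCard.1 hS).2]
    _ = _ := by rw [expect_add_distrib, expect_const hne, expect_powersetCard_sum hH]

end StepMean

/-- The graphs which the process can reach. -/
inductive Reachable (m d : ℕ) : (n : ℕ) → SimpleGraph (Fin n) → Prop
  | base : Reachable m d m ⊤
  | step {n : ℕ} {H : SimpleGraph (Fin n)} {S : Finset (Fin n)} (h : Reachable m d n H)
      (hS : S ∈ (eligibleVertices d H).powersetCard m) : Reachable m d (n + 1) (addVertex H S)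

namespace Reachable

open scoped Classical

variable {m d n : ℕ} {H : SimpleGraph (Fin n)}

theorem le (h : Reachable m d n H) : m ≤ n := by
  induction h with
  | base => exact le_rfl
  | step _ _ ih => exact ih.trans (Nat.le_succ _)

theorem degree_le (hd : m ≤ d) (h : Reachable m d n H) (v : Fin n) : H.degree v ≤ d := by
  induction h with
  | base => rw [degree_top_fin]; omega
  | @step n H S _ hS ih =>
    rw [Finset.mem_powersetCard] at hS
    induction v using Fin.lastCases with
    | last => rw [degree_addVertex_last]; omega
    | cast v =>
      rw [degree_addVertex_castSucc]
      split_ifs with hv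
      · exact mem_eligibleVertices.1 (hS.1 hv)
      · exact ih v

theorem le_degree_add_one (h : Reachable m d n H) (v : Fin n) : m ≤ H.degree v + 1 := by
  induction h with
  | base => rw [degree_top_fin]; omega
  | @step n H S _ hS ih =>
    induction v using Fin.lastCases with
    | last => rw [degree_addVertex_last, (Finset.mem_powersetCard.1 hS).2]; omega
    | cast v =>
      rw [degree_addVertex_castSucc]
      have := ih v
      omega

theorem le_degree (h : Reachable m d n H) (hn : m < n) (v : Fin n) : m ≤ H.degree v := by
  induction h with
  | base => omega
  | @step n H S h hS ih =>
    have hcard := (Finset.mem_powersetCard.1 hS).2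
    induction v using Fin.lastCases with
    | last => rw [degree_addVertex_last, hcard]
    | cast v =>
      rw [degree_addVertex_castSucc]
      obtain rfl | hmn := h.le.eq_or_lt
      · have hS_univ : S = Finset.univ := (Finset.card_eq_iff_eq_univ S).1 (by simp [hcard])
        simpa only [hS_univ, Finset.mem_univ, if_true] using h.le_degree_add_one v
      · exact (ih hmn v).trans (Nat.le_add_right _ _)

theorem sum_degree (h : Reachable m d n H) :
    ∑ v, (H.degree v : ℝ) = 2 * m * n - m * (m + 1) := by
  induction h with
  | base =>
    obtain rfl | hm := m.eq_zero_or_pos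
    · simp
    · simp only [degree_top_fin, Finset.sum_const, Finset.card_univ, Fintype.card_fin, nsmul_eq_mul]
      push_cast [Nat.cast_sub hm]
      ring
  | @step n H S h hS ih =>
    rw [sum_degree_addVertex H S fun k => (k : ℝ), ih, (Finset.mem_powersetCard.1 hS).2]
    simp only [Nat.cast_add, Nat.cast_one, add_sub_cancel_left, Finset.sum_const,
      (Finset.mem_powersetCard.1 hS).2, nsmul_eq_mul]
    ring

theorem card_le_mul_card_eligibleVertices (hd : 2 * m < d) (h : Reachable m d n H) (hn : m < n) :
    (n : ℝ) + m * (m + 1) ≤ (m + 1) * (eligibleVertices d H).card := by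
  have hv (v : Fin n) : (2 * m + 1 : ℝ) ≤
      H.degree v + if v ∈ eligibleVertices d H then (m + 1 : ℝ) else 0 := by
    have := h.le_degree hn v
    split_ifs with hv <;> rw [mem_eligibleVertices] at hv <;> norm_cast <;> omega
  have hsum := Finset.card_nsmul_le_sum Finset.univ _ _ fun v _ => hv v
  rw [Finset.sum_add_distrib, h.sum_degree, ← Finset.sum_filter, Finset.filter_univ_mem,
    Finset.sum_const, Finset.card_univ, Fintype.card_fin, nsmul_eq_mul, nsmul_eq_mul] at hsum
  linarith

theorem le_card_eligibleVertices (hd : 2 * m < d) (h : Reachable m d n H) :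
    m ≤ (eligibleVertices d H).card := by
  obtain rfl | hmn := h.le.eq_or_lt
  · have huniv : eligibleVertices d H = Finset.univ := Finset.eq_univ_of_forall fun v => by
      have := H.degree_lt_card_verts v
      rw [Fintype.card_fin] at this
      exact mem_eligibleVertices.2 (by omega)
    rw [huniv, Finset.card_univ, Fintype.card_fin]
  · have hE : n + m * (m + 1) ≤ (m + 1) * (eligibleVertices d H).card := by
      exact_mod_cast h.card_le_mul_card_eligibleVertices hd hmn
    by_contra! hlt
    nlinarith

theorem sum_sub_mul_numDegree (hd : m ≤ d) (h : Reachable m d n H) (hn : m < n) :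
    ∑ k ∈ Finset.Ico m d, numDegree k H * ((d : ℝ) - k) = (d - 2 * m) * n + m * (m + 1) := by
  have hext : ∑ v ∈ eligibleVertices d H, ((d : ℝ) - H.degree v) = ∑ v, ((d : ℝ) - H.degree v) := by
    refine Finset.sum_subset (Finset.subset_univ _) fun v _ hv => ?_
    rw [mem_eligibleVertices, not_lt] at hv
    rw [(h.degree_le hd v).antisymm hv, sub_self]
  rw [← sum_eligibleVertices_degree (h.le_degree hn) fun k => (d : ℝ) - k, hext,
    Finset.sum_sub_distrib, h.sum_degree, Finset.sum_const, Finset.card_univ, Fintype.card_fin,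
    nsmul_eq_mul]
  ring

theorem numDegree_top (hd : m ≤ d) (h : Reachable m d n H) :
    (numDegree d H : ℝ) = n - (eligibleVertices d H).card := by
  have hfilter : Finset.univ.filter (H.degree · = d) = (eligibleVertices d H)ᶜ := by
    ext v
    simpa [mem_eligibleVertices] using (h.degree_le hd v).ge_iff_eq.symm
  rw [numDegree, hfilter, eq_sub_iff_add_eq, ← Nat.cast_add, Finset.card_compl_add_card,
    Fintype.card_fin]

theorem stepMean_numDegree_self (hm : 1 ≤ m) (hd : 2 * m < d) (h : Reachable m d n H)
    (hn : m < n) :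
    stepMean m d (fun H' => (numDegree m H' : ℝ)) H = numDegree m H +
      m / (eligibleVertices d H).card * ((eligibleVertices d H).card / m - numDegree m H) := by
  have hE := h.le_card_eligibleVertices hd
  have hm0 : (0 : ℝ) < m := by exact_mod_cast hm
  have hE0 : (0 : ℝ) < (eligibleVertices d H).card := by exact_mod_cast hm.trans hE
  have hnew : m / (eligibleVertices d H).card * ((eligibleVertices d H).card / m) = (1 : ℝ) := by
    rw [div_mul_div_cancel₀ hE0.ne', div_self hm0.ne']
  have hnone : ∑ v ∈ eligibleVertices d H, (if H.degree v + 1 = m then (1 : ℝ) else 0) = 0 :=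
    Finset.sum_eq_zero fun v _ => if_neg (by have := h.le_degree hn v; omega)
  simp only [numDegree_eq_sum]
  rw [stepMean_sum_degree hE fun k => if k = m then 1 else 0, Finset.sum_sub_distrib, hnone,
    sum_eligibleVertices_boole H (by omega : m < d), ← numDegree_eq_sum, if_pos rfl]
  linear_combination -hnew

theorem stepMean_numDegree_succ (hd : 2 * m < d) (h : Reachable m d n H) {k : ℕ} (hk : m ≤ k)
    (hkd : k + 1 < d) :
    stepMean m d (fun H' => (numDegree (k + 1) H' : ℝ)) H = numDegree (k + 1) H +
      m / (eligibleVertices d H).card * (numDegree k H - numDegree (k + 1) H) := by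
  simp only [numDegree_eq_sum (k := k + 1)]
  rw [stepMean_sum_degree (h.le_card_eligibleVertices hd) fun j => if j = k + 1 then 1 else 0,
    Finset.sum_sub_distrib, sum_eligibleVertices_boole H hkd, if_neg (by omega), add_zero,
    ← numDegree_eq_sum]
  simp only [Nat.add_right_cancel_iff]
  rw [sum_eligibleVertices_boole H (by omega : k < d)]

end Reachable

section History

variable {Ω : Type*} {m : ℕ} {G : (n : ℕ) → Ω → SimpleGraph (Fin n)}

/-- The graphs `G m, …, G n`. -/
def history (m : ℕ) (G : (n : ℕ) → Ω → SimpleGraph (Fin n)) (n : ℕ) (ω : Ω) :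
    (i : Finset.Icc m n) → SimpleGraph (Fin i) :=
  fun i => G i ω

theorem history_eq_iff {n : ℕ} {ω ω' : Ω} :
    history m G n ω = history m G n ω' ↔ ∀ i ∈ Finset.Icc m n, G i ω = G i ω' := by
  simp only [history, funext_iff, Subtype.forall]

theorem eq_of_history_eq {n : ℕ} (hn : m ≤ n) {ω ω' : Ω}
    (h : history m G n ω = history m G n ω') : G n ω = G n ω' :=
  history_eq_iff.1 h n (Finset.right_mem_Icc.2 hn)

/-- The event that the history up to time `n` is that of `ω₀` and the next vertex is joined
to `S`. -/
def stepEvent (m : ℕ) (G : (n : ℕ) → Ω → SimpleGraph (Fin n)) (n : ℕ) (ω₀ : Ω)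
    (S : Finset (Fin n)) : Set Ω :=
  history m G n ⁻¹' {history m G n ω₀} ∩ {ω | G (n + 1) ω = addVertex (G n ω₀) S}

theorem pairwise_disjoint_stepEvent (n : ℕ) (ω₀ : Ω) :
    Pairwise (Function.onFun Disjoint (stepEvent m G n ω₀)) :=
  fun _ _ hST => Set.disjoint_left.2 fun _ hS hT =>
    hST (addVertex_injective (G n ω₀) (hS.2.symm.trans hT.2))

end History

namespace IsBoundedUniformAttachment

variable {Ω : Type*} [MeasurableSpace Ω] {μ : Measure Ω} {m d : ℕ}
  {G : (n : ℕ) → Ω → SimpleGraph (Fin n)}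

theorem measurableSet_history (hG : IsBoundedUniformAttachment μ m d G) (n : ℕ)
    (x : (i : Finset.Icc m n) → SimpleGraph (Fin i)) :
    MeasurableSet (history m G n ⁻¹' {x}) := by
  have hinter : history m G n ⁻¹' {x} = ⋂ i : Finset.Icc m n, {ω | G i ω = x i} := by
    ext ω
    simp [history, funext_iff]
  rw [hinter]
  exact MeasurableSet.iInter fun i => hG.measurableSet_eq i (Finset.mem_Icc.1 i.2).1 _

/-- The filtration generated by the process from time `m` on; it is trivial before time `m`. -/
def filtration (hG : IsBoundedUniformAttachment μ m d G) : Filtration ℕ ‹MeasurableSpace Ω› where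
  seq n := MeasurableSpace.comap (history m G n) ⊤
  mono' i j hij := by
    let restrict (x : (k : Finset.Icc m j) → SimpleGraph (Fin k)) (k : Finset.Icc m i) :
      SimpleGraph (Fin k) := x ⟨k, Finset.Icc_subset_Icc_right hij k.2⟩
    change MeasurableSpace.comap (restrict ∘ history m G j) ⊤ ≤ _
    rw [← MeasurableSpace.comap_comp]
    exact MeasurableSpace.comap_mono le_top
  le' n := comap_top_le_of_measurableSet_preimage_singleton (hG.measurableSet_history n)

theorem stronglyMeasurable_comp (hG : IsBoundedUniformAttachment μ m d G) {n : ℕ} (hn : m ≤ n)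
    (ψ : SimpleGraph (Fin n) → ℝ) : StronglyMeasurable[hG.filtration n] fun ω => ψ (G n ω) :=
  Measurable.stronglyMeasurable <|
    (measurable_from_top (f := fun x : (i : Finset.Icc m n) → SimpleGraph (Fin i) =>
      ψ (x ⟨n, Finset.right_mem_Icc.2 hn⟩))).comp (comap_measurable (history m G n))

theorem measurableSet_stepEvent (hG : IsBoundedUniformAttachment μ m d G) {n : ℕ} (hn : m ≤ n)
    (ω₀ : Ω) (S : Finset (Fin n)) : MeasurableSet (stepEvent m G n ω₀ S) :=
  (hG.measurableSet_history n _).inter (hG.measurableSet_eq _ (by omega) _)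

theorem measureReal_stepEvent (hG : IsBoundedUniformAttachment μ m d G) {n : ℕ} (hn : m ≤ n)
    (ω₀ : Ω) {S : Finset (Fin n)} (hS : S ∈ (eligibleVertices d (G n ω₀)).powersetCard m) :
    μ.real (stepEvent m G n ω₀ S) = μ.real (history m G n ⁻¹' {history m G n ω₀}) *
      (1 / ((eligibleVertices d (G n ω₀)).card.choose m : ℝ)) := by
  have h := hG.step n hn (fun i => G i ω₀) S hS
  simp only [← history_eq_iff] at h
  exact h

variable [IsFiniteMeasure μ]

theorem integrable_comp (hG : IsBoundedUniformAttachment μ m d G) {n : ℕ}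
    (hn : m ≤ n) (ψ : SimpleGraph (Fin n) → ℝ) : Integrable (fun ω => ψ (G n ω)) μ := by
  obtain ⟨C, hC⟩ := (Set.finite_range fun H => ‖ψ H‖).bddAbove
  exact .of_bound ((hG.stronglyMeasurable_comp hn ψ).mono (hG.filtration.le n)).aestronglyMeasurable
    C (ae_of_all _ fun ω => hC ⟨G n ω, rfl⟩)

theorem iUnion_stepEvent_ae_eq (hG : IsBoundedUniformAttachment μ m d G) {n : ℕ} (hn : m ≤ n)
    (ω₀ : Ω) (hE : m ≤ (eligibleVertices d (G n ω₀)).card) :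
    (⋃ S ∈ (eligibleVertices d (G n ω₀)).powersetCard m, stepEvent m G n ω₀ S) =ᵐ[μ]
      history m G n ⁻¹' {history m G n ω₀} := by
  have hC : (0 : ℝ) < (eligibleVertices d (G n ω₀)).card.choose m := by
    exact_mod_cast Nat.choose_pos hE
  refine ae_eq_of_subset_of_measure_ge (Set.iUnion₂_subset fun S _ => Set.inter_subset_left) ?_
    (Finset.measurableSet_biUnion _ fun S _ =>
      hG.measurableSet_stepEvent hn ω₀ S).nullMeasurableSet (measure_ne_top _ _)
  rw [← ENNReal.toReal_le_toReal (measure_ne_top _ _) (measure_ne_top _ _)]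
  change μ.real _ ≤ μ.real _
  rw [measureReal_biUnion_finset (fun S _ T _ h => pairwise_disjoint_stepEvent n ω₀ h)
    (fun S _ => hG.measurableSet_stepEvent hn ω₀ S),
    Finset.sum_congr rfl fun S hS => hG.measureReal_stepEvent hn ω₀ hS, Finset.sum_const,
    Finset.card_powersetCard, nsmul_eq_mul]
  field_simp
  exact le_rfl

theorem ae_exists_eq_addVertex (hG : IsBoundedUniformAttachment μ m d G) {n : ℕ} (hn : m ≤ n)
    (hE : ∀ᵐ ω ∂μ, m ≤ (eligibleVertices d (G n ω)).card) :
    ∀ᵐ ω ∂μ, ∃ S ∈ (eligibleVertices d (G n ω)).powersetCard m,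
      G (n + 1) ω = addVertex (G n ω) S := by
  have hfibre : ∀ x, ∀ᵐ ω ∂μ, history m G n ω = x → m ≤ (eligibleVertices d (G n ω)).card →
      ∃ S ∈ (eligibleVertices d (G n ω)).powersetCard m, G (n + 1) ω = addVertex (G n ω) S := by
    intro x
    by_cases hx : ∃ ω₀, history m G n ω₀ = x ∧ m ≤ (eligibleVertices d (G n ω₀)).card
    · obtain ⟨ω₀, rfl, hE₀⟩ := hx
      filter_upwards [(hG.iUnion_stepEvent_ae_eq hn ω₀ hE₀).mem_iff] with ω hω hhist _
      obtain ⟨S, hS, hstep⟩ := Set.mem_iUnion₂.1 (hω.2 hhist)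
      rw [eq_of_history_eq hn hhist]
      exact ⟨S, hS, hstep.2⟩
    · exact ae_of_all _ fun ω hhist hcard => absurd ⟨ω, hhist, hcard⟩ hx
  filter_upwards [hE, ae_all_iff.2 hfibre] with ω hcard hω
  exact hω _ rfl hcard

theorem ae_reachable (hd : 2 * m < d) (hG : IsBoundedUniformAttachment μ m d G) {n : ℕ}
    (hn : m ≤ n) : ∀ᵐ ω ∂μ, Reachable m d n (G n ω) := by
  induction n, hn using Nat.le_induction with
  | base =>
    filter_upwards [hG.initial] with ω hω
    rw [hω]
    exact Reachable.base
  | succ n hn ih =>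
    filter_upwards [ih, hG.ae_exists_eq_addVertex hn
      (ih.mono fun ω hω => hω.le_card_eligibleVertices hd)] with ω hω ⟨S, hS, hstep⟩
    rw [hstep]
    exact hω.step hS

theorem setIntegral_next (hG : IsBoundedUniformAttachment μ m d G) {n : ℕ} (hn : m ≤ n) (ω₀ : Ω)
    (hE : m ≤ (eligibleVertices d (G n ω₀)).card) (ψ : SimpleGraph (Fin (n + 1)) → ℝ) :
    ∫ ω in history m G n ⁻¹' {history m G n ω₀}, ψ (G (n + 1) ω) ∂μ =
      μ.real (history m G n ⁻¹' {history m G n ω₀}) * stepMean m d ψ (G n ω₀) := by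
  have hint : Integrable (fun ω => ψ (G (n + 1) ω)) μ := hG.integrable_comp (by omega) ψ
  rw [← setIntegral_congr_set (hG.iUnion_stepEvent_ae_eq hn ω₀ hE),
    integral_biUnion_finset _ (fun S _ => hG.measurableSet_stepEvent hn ω₀ S)
    (fun S _ T _ h => pairwise_disjoint_stepEvent n ω₀ h) (fun S _ => hint.integrableOn), stepMean,
    Finset.expect_eq_sum_div_card, Finset.card_powersetCard, mul_div_assoc', Finset.mul_sum,
    Finset.sum_div]
  refine Finset.sum_congr rfl fun S hS => ?_
  rw [setIntegral_congr_fun (g := fun _ => ψ (addVertex (G n ω₀) S))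
    (hG.measurableSet_stepEvent hn ω₀ S) (fun ω hω => congrArg ψ hω.2), setIntegral_const,
    hG.measureReal_stepEvent hn ω₀ hS, smul_eq_mul]
  ring

theorem condExp_next (hd : 2 * m < d) (hG : IsBoundedUniformAttachment μ m d G) {n : ℕ}
    (hn : m ≤ n) (ψ : SimpleGraph (Fin (n + 1)) → ℝ) :
    μ[fun ω => ψ (G (n + 1) ω) | hG.filtration n] =ᵐ[μ] fun ω => stepMean m d ψ (G n ω) := by
  refine condExp_comap_top_ae_eq (h := history m G n)
    (g := fun x => stepMean m d ψ (x ⟨n, Finset.right_mem_Icc.2 hn⟩))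
    (hG.measurableSet_history n) (hG.integrable_comp (by omega) ψ) fun x => ?_
  obtain hx | hx := eq_or_ne (μ (history m G n ⁻¹' {x})) 0
  · rw [setIntegral_measure_zero _ hx, measureReal_def, hx, ENNReal.toReal_zero, zero_mul]
  · obtain ⟨ω₀, rfl, hω₀⟩ : ∃ ω₀, history m G n ω₀ = x ∧ Reachable m d n (G n ω₀) :=
      ((frequently_ae_iff.2 hx).and_eventually (hG.ae_reachable hd hn)).exists
    exact hG.setIntegral_next hn ω₀ (hω₀.le_card_eligibleVertices hd) ψ

end IsBoundedUniformAttachment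

/-- The sum, over the steps of the process up to time `n`, of the differences between
`φ (G (s + 1))` and its conditional mean given `G s`: the martingale part of `φ (G n)` in its Doob
decomposition from time `m` on. -/
noncomputable def innovationSum {Ω : Type*} (m d : ℕ) (G : (n : ℕ) → Ω → SimpleGraph (Fin n))
    (φ : (n : ℕ) → SimpleGraph (Fin n) → ℝ) (n : ℕ) (ω : Ω) : ℝ :=
  ∑ s ∈ Finset.Ico m n, (φ (s + 1) (G (s + 1) ω) - stepMean m d (φ (s + 1)) (G s ω))

theorem innovationSum_succ {Ω : Type*} {m n : ℕ} (hn : m ≤ n) (d : ℕ)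
    (G : (n : ℕ) → Ω → SimpleGraph (Fin n)) (φ : (n : ℕ) → SimpleGraph (Fin n) → ℝ) (ω : Ω) :
    innovationSum m d G φ (n + 1) ω = innovationSum m d G φ n ω +
      (φ (n + 1) (G (n + 1) ω) - stepMean m d (φ (n + 1)) (G n ω)) :=
  Finset.sum_Ico_succ_top hn _

theorem innovationSum_of_le {Ω : Type*} {m n : ℕ} (hn : n ≤ m) (d : ℕ)
    (G : (n : ℕ) → Ω → SimpleGraph (Fin n)) (φ : (n : ℕ) → SimpleGraph (Fin n) → ℝ) (ω : Ω) :
    innovationSum m d G φ n ω = 0 := by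
  rw [innovationSum, Finset.Ico_eq_empty_of_le hn, Finset.sum_empty]

namespace IsBoundedUniformAttachment

variable {Ω : Type*} [MeasurableSpace Ω] {μ : Measure Ω} [IsFiniteMeasure μ] {m d : ℕ}
  {G : (n : ℕ) → Ω → SimpleGraph (Fin n)}

theorem martingale_innovationSum (hd : 2 * m < d) (hG : IsBoundedUniformAttachment μ m d G)
    (φ : (n : ℕ) → SimpleGraph (Fin n) → ℝ) :
    Martingale (innovationSum m d G φ) hG.filtration μ := by
  have hadapted : StronglyAdapted hG.filtration (innovationSum m d G φ) := fun n =>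
    Finset.stronglyMeasurable_fun_sum _ fun s hs => by
      obtain ⟨hms, hsn⟩ := Finset.mem_Ico.1 hs
      exact ((hG.stronglyMeasurable_comp (by omega) _).mono (hG.filtration.mono hsn)).sub
        ((hG.stronglyMeasurable_comp hms _).mono (hG.filtration.mono hsn.le))
  have hint (n : ℕ) : Integrable (innovationSum m d G φ n) μ :=
    integrable_finsetSum _ fun s hs => by
      obtain ⟨hms, -⟩ := Finset.mem_Ico.1 hs
      exact (hG.integrable_comp (by omega) _).sub (hG.integrable_comp hms _)
  refine martingale_nat hadapted hint fun n => ?_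
  obtain hn | hn := lt_or_ge n m
  · have hzero (k : ℕ) (hk : k ≤ m) : innovationSum m d G φ k = 0 :=
      funext (innovationSum_of_le hk d G φ)
    rw [hzero n hn.le, hzero (n + 1) hn, condExp_zero]
  · have hsucc : innovationSum m d G φ (n + 1) = innovationSum m d G φ n +
        ((fun ω => φ (n + 1) (G (n + 1) ω)) - fun ω => stepMean m d (φ (n + 1)) (G n ω)) :=
      funext (innovationSum_succ hn d G φ)
    have hnext := hG.integrable_comp (by omega : m ≤ n + 1) (φ (n + 1))
    have hmean := hG.integrable_comp hn (stepMean m d (φ (n + 1)))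
    have hle := hG.filtration.le n
    rw [hsucc]
    filter_upwards [condExp_add (hint n) (hnext.sub hmean) (hG.filtration n),
      condExp_sub hnext hmean (hG.filtration n), hG.condExp_next hd hn (φ (n + 1))]
      with ω hadd hsub hcond
    rw [hadd, Pi.add_apply, hsub, Pi.sub_apply, hcond,
      condExp_of_stronglyMeasurable hle (hadapted n) (hint n),
      condExp_of_stronglyMeasurable hle (hG.stronglyMeasurable_comp hn _) hmean, sub_self, add_zero]

theorem ae_abs_innovationSum_succ_sub_le (hd : 2 * m < d)
    (hG : IsBoundedUniformAttachment μ m d G) {φ : (n : ℕ) → SimpleGraph (Fin n) → ℝ} {c : NNReal}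
    (hφ : ∀ n (H : SimpleGraph (Fin n)) (S : Finset (Fin n)), S.card = m →
      |φ (n + 1) (addVertex H S) - φ n H| ≤ c) (n : ℕ) :
    ∀ᵐ ω ∂μ, |innovationSum m d G φ (n + 1) ω - innovationSum m d G φ n ω| ≤ (2 * c : NNReal) := by
  obtain hn | hn := lt_or_ge n m
  · exact ae_of_all _ fun ω => by
      rw [innovationSum_of_le hn, innovationSum_of_le hn.le, sub_zero, abs_zero]
      exact NNReal.coe_nonneg _
  · filter_upwards [hG.ae_reachable hd hn, hG.ae_exists_eq_addVertex hn
      ((hG.ae_reachable hd hn).mono fun ω hω => hω.le_card_eligibleVertices hd)]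
      with ω hω ⟨S, hS, hstep⟩
    have hmean : |stepMean m d (φ (n + 1)) (G n ω) - φ n (G n ω)| ≤ c :=
      abs_stepMean_sub_le (hω.le_card_eligibleVertices hd) fun T hT =>
        hφ n _ T (Finset.mem_powersetCard.1 hT).2
    have hnext := hφ n (G n ω) S (Finset.mem_powersetCard.1 hS).2
    rw [innovationSum_succ hn, add_sub_cancel_left, hstep]
    push_cast
    rw [abs_le] at *
    constructor <;> linarith

omit [IsFiniteMeasure μ] in
theorem ae_isBigO_innovationSum [IsProbabilityMeasure μ] (hd : 2 * m < d)
    (hG : IsBoundedUniformAttachment μ m d G)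
    {φ : (n : ℕ) → SimpleGraph (Fin n) → ℝ} {c : NNReal}
    (hφ : ∀ n (H : SimpleGraph (Fin n)) (S : Finset (Fin n)), S.card = m →
      |φ (n + 1) (addVertex H S) - φ n H| ≤ c) :
    ∀ᵐ ω ∂μ, (fun n => innovationSum m d G φ n ω) =O[atTop] fun n : ℕ => √(n * Real.log n) := by
  simpa only [innovationSum_of_le m.zero_le, sub_zero] using
    ae_isBigO_sqrt_mul_log_of_abs_sub_le (hG.martingale_innovationSum hd φ)
      (hG.ae_abs_innovationSum_succ_sub_le hd hφ)

end IsBoundedUniformAttachment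

section DegreeVector

/-- The numbers of vertices of degrees `m, …, m + p`; for the process with `d = m + p + 1` these are
the degrees of the eligible vertices. -/
noncomputable def degreeVector (m p : ℕ) {n : ℕ} (H : SimpleGraph (Fin n)) : Fin (p + 1) → ℝ :=
  fun i => numDegree (m + i) H

namespace Reachable

variable {m p n : ℕ} {H : SimpleGraph (Fin n)}

theorem sum_degreeVector (h : Reachable m (m + p + 1) n H) (hn : m < n) :
    ∑ i, degreeVector m p H i = (eligibleVertices (m + p + 1) H).card := by
  classical
  have hsum := sum_eligibleVertices_degree (d := m + p + 1) (h.le_degree hn) fun _ => 1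
  rw [Finset.sum_const, nsmul_one] at hsum
  rw [hsum, Finset.sum_Ico_eq_sum_range, add_assoc, Nat.add_sub_cancel_left, Finset.sum_range]
  simp only [degreeVector, mul_one]

theorem totalDeficit_degreeVector (h : Reachable m (m + p + 1) n H) (hn : m < n) :
    totalDeficit p (degreeVector m p H) = (p + 1 - m) * n + m * (m + 1) := by
  have hsum := h.sum_sub_mul_numDegree (by omega) hn
  rw [Finset.sum_Ico_eq_sum_range, add_assoc, Nat.add_sub_cancel_left, Finset.sum_range] at hsum
  push_cast at hsum
  rw [totalDeficit_apply, show (p + 1 - m : ℝ) = m + (p + 1) - 2 * m by ring, ← hsum]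
  exact Finset.sum_congr rfl fun i _ => by rw [degreeVector]; ring

theorem stepMean_degreeVector (hm : 1 ≤ m) (hd : 2 * m < m + p + 1)
    (h : Reachable m (m + p + 1) n H) (hn : m < n) (i : Fin (p + 1)) :
    stepMean m (m + p + 1) (fun H' => degreeVector m p H' i) H =
      degreeVector m p H i + m / (eligibleVertices (m + p + 1) H).card *
        (feedbackShift (fun _ => (m : ℝ)⁻¹) (degreeVector m p H) i - degreeVector m p H i) := by
  cases i using Fin.cases with
  | zero =>
    rw [feedbackShift_zero, ← Finset.mul_sum, h.sum_degreeVector hn, ← div_eq_inv_mul]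
    exact h.stepMean_numDegree_self hm hd hn
  | succ i =>
    have hi : m + (i : ℕ) + 1 < m + p + 1 := by have := i.isLt; omega
    exact h.stepMean_numDegree_succ hd (Nat.le_add_right m i) hi

end Reachable

end DegreeVector

section Path

variable {Ω : Type*} {m p : ℕ} {G : (n : ℕ) → Ω → SimpleGraph (Fin n)} {ω : Ω}

theorem isBigO_div_card_eligibleVertices {d : ℕ} (hm : 1 ≤ m) (hd : 2 * m < d)
    (hreach : ∀ n, m ≤ n → Reachable m d n (G n ω)) :
    (fun n => (m : ℝ) / (eligibleVertices d (G n ω)).card) =O[atTop]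
      fun n : ℕ => ((n : ℝ) + 1)⁻¹ := by
  refine IsBigO.of_bound (m * (m + 1)) ((eventually_gt_atTop m).mono fun n hn => ?_)
  have hcard := (hreach n hn.le).card_le_mul_card_eligibleVertices hd hn
  have hm1 : (1 : ℝ) ≤ m := by exact_mod_cast hm
  have hE : (0 : ℝ) < (eligibleVertices d (G n ω)).card := by
    exact_mod_cast hm.trans ((hreach n hn.le).le_card_eligibleVertices hd)
  rw [Real.norm_of_nonneg (by positivity), Real.norm_of_nonneg (by positivity),
    ← div_eq_mul_inv, div_le_div_iff₀ hE (by positivity), mul_assoc]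
  gcongr
  nlinarith

theorem degreeVector_succ (hm : 1 ≤ m) (hd : 2 * m < m + p + 1) {n : ℕ} (hn : m < n)
    (h : Reachable m (m + p + 1) n (G n ω)) {L : ℕ → Fin (p + 1) → ℝ}
    (hL : ∀ n i, L n i =
      innovationSum m (m + p + 1) G (fun _ H => (numDegree (m + i) H : ℝ)) n ω) :
    degreeVector m p (G (n + 1) ω) = degreeVector m p (G n ω) +
      ((m : ℝ) / (eligibleVertices (m + p + 1) (G n ω)).card) •
        (feedbackShift (fun _ => (m : ℝ)⁻¹) (degreeVector m p (G n ω)) -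
          degreeVector m p (G n ω)) + (L (n + 1) - L n) := by
  ext i
  have hmean := h.stepMean_degreeVector hm hd hn i
  simp only [Pi.add_apply, Pi.sub_apply, Pi.smul_apply, smul_eq_mul, ← hmean, hL,
    innovationSum_succ hn.le, add_sub_cancel_left]
  exact (add_sub_cancel _ _).symm

theorem isBigO_degreeVector_sub (hm : 1 ≤ m) (hd : 2 * m < m + p + 1)
    (hreach : ∀ n, m ≤ n → Reachable m (m + p + 1) n (G n ω)) {x : ℝ}
    (hx : IsTopRoot m (m + p + 1) x) {β : ℝ} (hβ : 0 < β)
    (hL : ∀ k, (fun n => innovationSum m (m + p + 1) G (fun _ H => (numDegree k H : ℝ)) n ω)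
      =O[atTop] fun n : ℕ => (n : ℝ) ^ β) :
    (fun n : ℕ => degreeVector m p (G n ω) - (n : ℝ) • geometricProfile p (m / (m + 1 - x)))
      =O[atTop] fun n : ℕ => (n : ℝ) ^ β := by
  have hm0 : (0 : ℝ) < m := by exact_mod_cast hm
  have hstep : ∀ᶠ n in atTop,
      (m : ℝ) / (eligibleVertices (m + p + 1) (G n ω)).card ∈ Set.Icc (0 : ℝ) 1 := by
    filter_upwards [eventually_ge_atTop m] with n hn
    exact ⟨by positivity, div_le_one_of_le₀
      (by exact_mod_cast (hreach n hn).le_card_eligibleVertices hd) (by positivity)⟩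
  exact isBigO_sub_smul_geometricProfile (div_pos hm0 (hx.add_one_sub_pos hd)).le hm0.ne'
    (hx.sum_pow_succ_eq hd) hβ hstep (isBigO_div_card_eligibleVertices hm hd hreach)
    (isBigO_pi.2 fun i : Fin (p + 1) => hL (m + i))
    ((eventually_gt_atTop m).mono fun n hn =>
      degreeVector_succ hm hd hn (hreach n hn.le) fun _ _ => rfl)
    ((eventually_gt_atTop m).mono fun n hn => (hreach n hn.le).totalDeficit_degreeVector hn)

theorem isBigO_numDegree_sub_mul_limitProportion {d : ℕ} (hm : 1 ≤ m) (hd : 2 * m < d)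
    (hreach : ∀ n, m ≤ n → Reachable m d n (G n ω)) {x : ℝ} (hx : IsTopRoot m d x) {β : ℝ}
    (hβ : 0 < β) (hL : ∀ k, (fun n => innovationSum m d G (fun _ H => (numDegree k H : ℝ)) n ω)
      =O[atTop] fun n : ℕ => (n : ℝ) ^ β) {k : ℕ} (hk : k ∈ Finset.Icc m d) :
    (fun n : ℕ => (numDegree k (G n ω) : ℝ) - n * limitProportion m d x k)
      =O[atTop] fun n : ℕ => (n : ℝ) ^ β := by
  obtain ⟨hmk, hkd⟩ := Finset.mem_Icc.1 hk
  obtain ⟨p, rfl⟩ := Nat.exists_eq_add_of_lt (by omega : m < d)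
  have hdev := isBigO_pi.1 (isBigO_degreeVector_sub hm hd hreach hx hβ hL)
  obtain hlt | rfl := hkd.lt_or_eq
  · obtain ⟨i, rfl⟩ := Nat.exists_eq_add_of_le hmk
    simpa only [← hx.limitProportion_eq_geometricProfile hd, degreeVector, Pi.sub_apply,
      Pi.smul_apply, smul_eq_mul] using hdev ⟨i, by omega⟩
  · refine (IsBigO.sum fun i (_ : i ∈ Finset.univ) => hdev i).neg_left.congr' ?_ .rfl
    filter_upwards [eventually_gt_atTop m] with n hn
    simp only [Finset.sum_apply, Pi.sub_apply, Pi.smul_apply, smul_eq_mul, Finset.sum_sub_distrib,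
      ← Finset.mul_sum, (hreach n hn.le).sum_degreeVector hn, sum_geometricProfile, hx.pow_succ_eq,
      limitProportion, if_true, (hreach n hn.le).numDegree_top (by omega)]
    ring

end Path

theorem mainTheorem2 {Ω : Type*} [MeasurableSpace Ω] (μ : Measure Ω) [IsProbabilityMeasure μ]
    (m d : ℕ) (hm : 1 ≤ m) (hd : 2 * m < d)
    (G : (n : ℕ) → Ω → SimpleGraph (Fin n)) (hG : IsBoundedUniformAttachment μ m d G) :
    (∃! x : ℝ, IsTopRoot m d x) ∧
    ∀ x : ℝ, IsTopRoot m d x →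
      ∀ᵐ ω ∂μ, ∀ k ∈ Finset.Icc m d,
        Tendsto (fun n : ℕ => (numDegree k (G n ω) : ℝ) / n) atTop
          (𝓝 (limitProportion m d x k)) ∧
        ∀ δ : ℝ, 0 < δ →
          (fun n : ℕ => |(numDegree k (G n ω) : ℝ) / n - limitProportion m d x k|)
            =o[atTop] fun n : ℕ => (n : ℝ) ^ (-(1 / 2 : ℝ) + δ) := by
  refine ⟨existsUnique_isTopRoot hm hd, fun x hx => ?_⟩
  have hinnovation : ∀ᵐ ω ∂μ, ∀ k,
      (fun n => innovationSum m d G (fun _ H => (numDegree k H : ℝ)) n ω)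
        =O[atTop] fun n : ℕ => √(n * Real.log n) :=
    ae_all_iff.2 fun k => hG.ae_isBigO_innovationSum hd (c := m + 1) fun n H S hS => by
      simpa [hS] using abs_numDegree_addVertex_sub_le H S k
  have hreach : ∀ᵐ ω ∂μ, ∀ n, m ≤ n → Reachable m d n (G n ω) :=
    ae_all_iff.2 fun n => eventually_imp_distrib_left.2 (hG.ae_reachable hd)
  filter_upwards [hinnovation, hreach] with ω hω hωreach k hk
  have hdeviation (β : ℝ) (hβ : 1 / 2 < β) :
      (fun n : ℕ => (numDegree k (G n ω) : ℝ) - n * limitProportion m d x k)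
        =O[atTop] fun n : ℕ => (n : ℝ) ^ β :=
    isBigO_numDegree_sub_mul_limitProportion hm hd hωreach hx (by linarith)
      (fun k => (hω k).trans (isBigO_sqrt_mul_log_rpow hβ)) hk
  exact ⟨tendsto_div_of_isBigO_sub hdeviation,
    fun δ hδ => isLittleO_abs_div_sub_of_isBigO_sub hdeviation hδ⟩
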